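/- Let $G$ be a Lie group (for instance a compact one) with Lie algebra $\mathfrak g$ (bracket of left-invariant vector fields), let $K$ be an $\mathrm{Ad}$-invariant inner product on $\mathfrak g$, and let $\{b_\sigma\}$ be a $K$-orthonormal basis of $\mathfrak g$ with structure constants $[b_\sigma,b_\beta]=\sum_\gamma C^\gamma_{\sigma\beta}b_\gamma$ and dual basis $\{b^\sigma\}$. Let $(M,h)$ be a Riemannian or pseudo-Riemannian manifold and $\pi:P\to M$ a smooth principal $G$-bundle, with $G$ acting on the left. For $p\in P$ let $I_p:\mathfrak g\to T_pP$ be the derivative at the identity of $g\mapsto g\cdot p$. Let $\omega$ be a connection form on $P$, that is, a smooth $\mathfrak g$-valued 1-form with $g^*\omega=\mathrm{Ad}(g)\,\omega$ and $\omega_p\circ I_p=\mathrm{id}_{\mathfrak g}$. Let $\Omega(X,Y)=d\omega(\widehat HX,\widehat HY)$ be its curvature, where $\widehat H$ is the projection onto $\ker\omega$ along the vertical bundle and $d\omega(X,Y)=X(\omega(Y))-Y(\omega(X))-\omega([X,Y])$. Give $P$ the bundle metric $$\alpha(u,v)=h(d\pi\,u,d\pi\,v)+K(\omega(u),\omega(v)).$$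 Let $\{X_i\}$ be a smooth $h$-orthonormal frame on an open set $\theta\subset M$, with $\varepsilon_i:=h(X_i,X_i)\in\{1,-1\}$ (so $\varepsilon_i=1$ for all $i$ if $h$ is Riemannian), and let $\{\lambda^i\}$ be its dual coframe. On $\pi^{-1}(\theta)$ let $e_i$ be the horizontal lift of $X_i$ and let $e_\sigma=I(b_\sigma)$; put $e^i=\pi^*\lambda^i$ and $e^\sigma=b^\sigma\circ\omega$. Then $\{e_i,e_\sigma\}$ is a smooth frame of $P$ over $\pi^{-1}(\theta)$, orthonormal for $\alpha$ (up to the signs of the squares), with dual coframe $\{e^i,e^\sigma\}$. Let $\Gamma^i_j$ and $\varpi^A_B$ ($A,B$ running over both kinds of indices) be the Levi-Civita connection forms of $(M,h)$ and $(P,\alpha)$ in these frames, defined by $\nabla^M X_j=\sum_i\Gamma^i_j\otimes X_i$ and $\nabla^P e_B=\sum_A\varpi^A_B\otimes e_A$, and let $F^\sigma_{ij}=b^\sigma(\Omega(e_i,e_j))$ be the components of the curvature of $\omega$, so that $\Omega=\tfrac12\sum F^\sigma_{ij}\,e^i\wedge e^j\otimes b_\sigma$. Then on $\pi^{-1}(\theta)$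 $$\varpi^i_j=\pi^*\Gamma^i_j-\tfrac12\,\varepsilon_i\sum_\sigma F^\sigma_{ij}\,e^\sigma,\qquad \varpi^\sigma_i=\tfrac12\sum_jF^\sigma_{ij}\,e^j,\qquad \varpi^\sigma_\beta=-\tfrac12\sum_\nu C^\sigma_{\nu\beta}\,e^\nu .$$ -/

import Mathlib

open Bundle
open scoped Manifold ContDiff

noncomputable section

namespace KaluzaKlein

/-! All manifolds are smooth, finite-dimensional and without boundary: a manifold `N` of dimension
`dim E` is a `ChartedSpace E N` with `IsManifold 𝓘(ℝ, E) ∞ N`. -/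

section Manifolds

variable {E : Type*} [NormedAddCommGroup E] [NormedSpace ℝ E]
  {N : Type*} [TopologicalSpace N] [ChartedSpace E N]

/-- A (pseudo-)Riemannian metric on the manifold `N`: a smooth field of symmetric nondegenerate
bilinear forms on the tangent spaces. -/
structure IsPseudoRiemannianMetric [IsManifold 𝓘(ℝ, E) ∞ N]
    (g : ∀ x : N, TangentSpace 𝓘(ℝ, E) x →L[ℝ] TangentSpace 𝓘(ℝ, E) x →L[ℝ] ℝ) : Prop where
  symm : ∀ (x : N) (u v : TangentSpace 𝓘(ℝ, E) x), g x u v = g x v u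
  nondegenerate : ∀ (x : N) (u : TangentSpace 𝓘(ℝ, E) x),
    (∀ v : TangentSpace 𝓘(ℝ, E) x, g x u v = 0) → u = 0
  contMDiff : ContMDiff 𝓘(ℝ, E) (𝓘(ℝ, E).prod 𝓘(ℝ, E →L[ℝ] E →L[ℝ] ℝ)) ∞
    (fun x : N ↦ TotalSpace.mk' (E →L[ℝ] E →L[ℝ] ℝ)
      (E := fun x : N ↦ TangentSpace 𝓘(ℝ, E) x →L[ℝ] TangentSpace 𝓘(ℝ, E) x →L[ℝ] ℝ) x (g x))

/-- The fields `s i` are pairwise orthogonal and have square `1` or `-1` at each point of `U`. -/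
structure IsOrthonormalOn {ι : Type*}
    (g : ∀ x : N, TangentSpace 𝓘(ℝ, E) x → TangentSpace 𝓘(ℝ, E) x → ℝ)
    (s : ι → ∀ x : N, TangentSpace 𝓘(ℝ, E) x) (U : Set N) : Prop where
  orthogonal : ∀ x ∈ U, ∀ i j, i ≠ j → g x (s i x) (s j x) = 0
  sq_eq : ∀ x ∈ U, ∀ i, g x (s i x) (s i x) = 1 ∨ g x (s i x) (s i x) = -1

/-- `cov` is the Levi-Civita connection of the metric `g`: it is torsion-free, and
`v⟨Y, Z⟩ = ⟨∇_v Y, Z⟩ + ⟨Y, ∇_v Z⟩`. Here `cov Y x v` is `∇_v Y` at the point `x`. -/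
structure IsLeviCivita [FiniteDimensional ℝ E] [IsManifold 𝓘(ℝ, E) ∞ N]
    (g : ∀ x : N, TangentSpace 𝓘(ℝ, E) x → TangentSpace 𝓘(ℝ, E) x → ℝ)
    (cov : CovariantDerivative 𝓘(ℝ, E) E (TangentSpace 𝓘(ℝ, E) : N → Type _)) : Prop where
  torsion_eq_zero :
    haveI : CompleteSpace E := FiniteDimensional.complete ℝ E
    cov.torsion = 0
  metric : ∀ (Y Z : ∀ x : N, TangentSpace 𝓘(ℝ, E) x) (x : N) (v : TangentSpace 𝓘(ℝ, E) x),
    MDiffAt (T% Y) x → MDiffAt (T% Z) x →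
      mvfderiv 𝓘(ℝ, E) (fun y ↦ g y (Y y) (Z y)) x v =
        g x (cov Y x v) (Z x) + g x (Y x) (cov Z x v)

/-- The connection forms `Γ^i_j` of `cov` in the local frame `s`, defined by
`∇_v s_j = ∑ i, Γ^i_j(v) s_i`. -/
def connectionForm [IsManifold 𝓘(ℝ, E) ∞ N] {ι : Type*} {s : ι → ∀ x : N, TangentSpace 𝓘(ℝ, E) x} {U : Set N}
    (hs : IsLocalFrameOn 𝓘(ℝ, E) E ∞ s U)
    (cov : CovariantDerivative 𝓘(ℝ, E) E (TangentSpace 𝓘(ℝ, E) : N → Type _))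
    (i j : ι) (x : N) (v : TangentSpace 𝓘(ℝ, E) x) : ℝ :=
  hs.coeff i x (cov (s j) x v)

end Manifolds

section LieGroups

variable {EG : Type*} [NormedAddCommGroup EG] [NormedSpace ℝ EG]
  {G : Type*} [TopologicalSpace G] [ChartedSpace EG G] [Group G]

/-- `Ad(g)`, the derivative at the identity of the conjugation `a ↦ g a g⁻¹`. -/
def Ad (g : G) : GroupLieAlgebra 𝓘(ℝ, EG) G →L[ℝ] GroupLieAlgebra 𝓘(ℝ, EG) G :=
  -- the target of this derivative is the tangent space at `g * 1 * g⁻¹ = 1`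
  (mfderiv 𝓘(ℝ, EG) 𝓘(ℝ, EG) (fun a : G ↦ g * a * g⁻¹) 1 : EG →L[ℝ] EG)

/-- `K` is an `Ad`-invariant inner product on the Lie algebra. -/
structure IsAdInvariantInnerProduct
    (K : LinearMap.BilinForm ℝ (GroupLieAlgebra 𝓘(ℝ, EG) G)) : Prop where
  symm : ∀ X Y, K X Y = K Y X
  pos : ∀ X, X ≠ 0 → 0 < K X X
  ad_invariant : ∀ (g : G) (X Y), K (Ad g X) (Ad g Y) = K X Y

/-- The structure constants `C^γ_{σβ}`, given by `[b_σ, b_β] = ∑ γ, C^γ_{σβ} b_γ`. -/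
def structureConstant {κ : Type*} (b : Module.Basis κ ℝ (GroupLieAlgebra 𝓘(ℝ, EG) G))
    (γ σ β : κ) : ℝ :=
  b.repr ⁅b σ, b β⁆ γ

end LieGroups

section PrincipalBundles

variable {EM EG EP : Type*}
  [NormedAddCommGroup EM] [NormedSpace ℝ EM]
  [NormedAddCommGroup EG] [NormedSpace ℝ EG]
  [NormedAddCommGroup EP] [NormedSpace ℝ EP]
  {M G P : Type*}
  [TopologicalSpace M] [ChartedSpace EM M]
  [TopologicalSpace G] [ChartedSpace EG G] [Group G]
  [TopologicalSpace P] [ChartedSpace EP P] [MulAction G P]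

variable (EM EG EP G) in
/-- `proj : P → M` is a smooth principal `G`-bundle for the given left action of `G` on `P`: the action
is smooth, and over small open sets `U` there are diffeomorphisms `φ : π⁻¹(U) → U × G`, lying over
`U`, which intertwine the action with left multiplication. (In particular the action is free, its
orbits are the fibres, and `proj` is a surjective submersion.) -/
structure IsPrincipalBundle (proj : P → M) : Prop where
  contMDiff_smul : ContMDiffSMul 𝓘(ℝ, EG) 𝓘(ℝ, EP) ∞ G P
  contMDiff_proj : ContMDiff 𝓘(ℝ, EP) 𝓘(ℝ, EM) ∞ proj
  proj_smul : ∀ (g : G) (p : P), proj (g • p) = proj p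
  exists_trivialization : ∀ x : M, ∃ (U : Set M) (φ : OpenPartialHomeomorph P (M × G)),
    IsOpen U ∧ x ∈ U ∧ φ.source = proj ⁻¹' U ∧ φ.target = U ×ˢ Set.univ ∧
    ContMDiffOn 𝓘(ℝ, EP) (𝓘(ℝ, EM).prod 𝓘(ℝ, EG)) ∞ φ φ.source ∧
    ContMDiffOn (𝓘(ℝ, EM).prod 𝓘(ℝ, EG)) 𝓘(ℝ, EP) ∞ φ.symm φ.target ∧
    (∀ p ∈ φ.source, (φ p).1 = proj p) ∧
    (∀ p ∈ φ.source, ∀ g : G, (φ (g • p)).2 = g * (φ p).2)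

variable (EG EP G) in
/-- `I_p : 𝔤 → T_pP`, the derivative at the identity of the orbit map `g ↦ g • p`; thus `I_p(X)` is
the velocity of `exp(tX) • p` at `t = 0`. -/
def infinitesimalAction (p : P) :
    GroupLieAlgebra 𝓘(ℝ, EG) G →L[ℝ] TangentSpace 𝓘(ℝ, EP) p :=
  -- the target of this derivative is the tangent space at `1 • p = p`
  (mfderiv 𝓘(ℝ, EG) 𝓘(ℝ, EP) (fun g : G ↦ g • p) 1 : EG →L[ℝ] EP)

/-- A connection form `ω` (here `conn`): a smooth `𝔤`-valued 1-form on `P` such that `g^*ω = Ad(g) ω` and which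
inverts `I_p` on vertical vectors. -/
structure IsConnectionForm [IsManifold 𝓘(ℝ, EP) ∞ P]
    (conn : ∀ p : P, TangentSpace 𝓘(ℝ, EP) p →L[ℝ] GroupLieAlgebra 𝓘(ℝ, EG) G) : Prop where
  contMDiff : ContMDiff (M' := EG) 𝓘(ℝ, EP).tangent 𝓘(ℝ, EG) ∞
    (fun v : TangentBundle 𝓘(ℝ, EP) P ↦ conn v.proj v.snd)
  equivariant : ∀ (g : G) (p : P) (v : TangentSpace 𝓘(ℝ, EP) p),
    conn (g • p) (mfderiv 𝓘(ℝ, EP) 𝓘(ℝ, EP) (fun q : P ↦ g • q) p v) = Ad g (conn p v)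
  apply_infinitesimalAction : ∀ (p : P) (X : GroupLieAlgebra 𝓘(ℝ, EG) G),
    conn p (infinitesimalAction EG EP G p X) = X

/-- The derivative `v(f)` of a Lie algebra valued function along a tangent vector. -/
def directionalDerivative (f : P → GroupLieAlgebra 𝓘(ℝ, EG) G) (p : P)
    (v : TangentSpace 𝓘(ℝ, EP) p) : GroupLieAlgebra 𝓘(ℝ, EG) G :=
  -- the Lie algebra has the model vector space `EG` as its underlying vector space
  (mvfderiv 𝓘(ℝ, EP) (F := EG) f p v : EG)

/-- The exterior derivative of a Lie algebra valued 1-form, evaluated on differentiable fields: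
`dω(X, Y) = X(ω(Y)) - Y(ω(X)) - ω([X, Y])`. -/
def exteriorDerivative
    (conn : ∀ p : P, TangentSpace 𝓘(ℝ, EP) p →L[ℝ] GroupLieAlgebra 𝓘(ℝ, EG) G)
    (X Y : ∀ p : P, TangentSpace 𝓘(ℝ, EP) p) (p : P) : GroupLieAlgebra 𝓘(ℝ, EG) G :=
  directionalDerivative (fun q ↦ conn q (Y q)) p (X p) -
    directionalDerivative (fun q ↦ conn q (X q)) p (Y p) -
    conn p (VectorField.mlieBracket 𝓘(ℝ, EP) X Y p)

/-- The projection of a vector field onto the horizontal subbundle `ker ω`. -/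
def horizontalPart
    (conn : ∀ p : P, TangentSpace 𝓘(ℝ, EP) p →L[ℝ] GroupLieAlgebra 𝓘(ℝ, EG) G)
    (X : ∀ p : P, TangentSpace 𝓘(ℝ, EP) p) (p : P) : TangentSpace 𝓘(ℝ, EP) p :=
  X p - infinitesimalAction EG EP G p (conn p (X p))

/-- The curvature `Ω(X, Y) = dω(Ĥ X, Ĥ Y)`, where `Ĥ` is the horizontal projection. -/
def curvature
    (conn : ∀ p : P, TangentSpace 𝓘(ℝ, EP) p →L[ℝ] GroupLieAlgebra 𝓘(ℝ, EG) G)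
    (X Y : ∀ p : P, TangentSpace 𝓘(ℝ, EP) p) : P → GroupLieAlgebra 𝓘(ℝ, EG) G :=
  exteriorDerivative conn (horizontalPart conn X) (horizontalPart conn Y)

/-- The bundle metric `π^*h + K ∘ ω` on `P`. -/
def bundleMetric (proj : P → M)
    (h : ∀ x : M, TangentSpace 𝓘(ℝ, EM) x →L[ℝ] TangentSpace 𝓘(ℝ, EM) x →L[ℝ] ℝ)
    (K : LinearMap.BilinForm ℝ (GroupLieAlgebra 𝓘(ℝ, EG) G))
    (conn : ∀ p : P, TangentSpace 𝓘(ℝ, EP) p →L[ℝ] GroupLieAlgebra 𝓘(ℝ, EG) G)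
    (p : P) (u v : TangentSpace 𝓘(ℝ, EP) p) : ℝ :=
  h (proj p) (mfderiv 𝓘(ℝ, EP) 𝓘(ℝ, EM) proj p u) (mfderiv 𝓘(ℝ, EP) 𝓘(ℝ, EM) proj p v) +
    K (conn p u) (conn p v)

/-- The horizontal lift to `p` of a tangent vector at `proj p`: the unique vector in `ker ω` that
`dπ` maps to it. -/
def horizontalLift (proj : P → M)
    (conn : ∀ p : P, TangentSpace 𝓘(ℝ, EP) p →L[ℝ] GroupLieAlgebra 𝓘(ℝ, EG) G)
    (p : P) (v : TangentSpace 𝓘(ℝ, EM) (proj p)) : TangentSpace 𝓘(ℝ, EP) p :=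
  Classical.epsilon fun u ↦ conn p u = 0 ∧ mfderiv 𝓘(ℝ, EP) 𝓘(ℝ, EM) proj p u = v

/-- The frame of `P` adapted to a frame `X` of `M` and a basis `b` of `𝔤`: the horizontal lifts
`e_i` of the `X_i`, and the vertical fields `e_σ = I(b_σ)`. -/
def adaptedFrame {ι κ : Type*} (proj : P → M)
    (conn : ∀ p : P, TangentSpace 𝓘(ℝ, EP) p →L[ℝ] GroupLieAlgebra 𝓘(ℝ, EG) G)
    (X : ι → ∀ x : M, TangentSpace 𝓘(ℝ, EM) x)
    (b : Module.Basis κ ℝ (GroupLieAlgebra 𝓘(ℝ, EG) G)) :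
    ι ⊕ κ → ∀ p : P, TangentSpace 𝓘(ℝ, EP) p
  | .inl i => fun p ↦ horizontalLift proj conn p (X i (proj p))
  | .inr σ => fun p ↦ infinitesimalAction EG EP G p (b σ)

/-- The 1-forms `e^i = π^*λ^i` (with `λ` the coframe dual to `X`) and `e^σ = b^σ ∘ ω` (with `b^σ`
the basis dual to `b`). -/
def adaptedCoframe [IsManifold 𝓘(ℝ, EM) ∞ M] {ι κ : Type*} (proj : P → M)
    (conn : ∀ p : P, TangentSpace 𝓘(ℝ, EP) p →L[ℝ] GroupLieAlgebra 𝓘(ℝ, EG) G)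
    {X : ι → ∀ x : M, TangentSpace 𝓘(ℝ, EM) x} {θ : Set M}
    (hX : IsLocalFrameOn 𝓘(ℝ, EM) EM ∞ X θ)
    (b : Module.Basis κ ℝ (GroupLieAlgebra 𝓘(ℝ, EG) G)) :
    ι ⊕ κ → ∀ p : P, TangentSpace 𝓘(ℝ, EP) p → ℝ
  | .inl i => fun p v ↦ hX.coeff i (proj p) (mfderiv 𝓘(ℝ, EP) 𝓘(ℝ, EM) proj p v)
  | .inr σ => fun p v ↦ b.repr (conn p v) σ

/-- The curvature components `F^σ_{ij} = Ω^σ(e_i, e_j)` in the adapted frame, so that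
`Ω = ½ ∑ F^σ_{ij} e^i ∧ e^j ⊗ b_σ`. -/
def curvatureComponent {ι κ : Type*} (proj : P → M)
    (conn : ∀ p : P, TangentSpace 𝓘(ℝ, EP) p →L[ℝ] GroupLieAlgebra 𝓘(ℝ, EG) G)
    (X : ι → ∀ x : M, TangentSpace 𝓘(ℝ, EM) x)
    (b : Module.Basis κ ℝ (GroupLieAlgebra 𝓘(ℝ, EG) G)) (σ : κ) (i j : ι) (p : P) : ℝ :=
  b.repr (curvature conn (adaptedFrame proj conn X b (.inl i)) (adaptedFrame proj conn X b (.inl j)) p) σ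

end PrincipalBundles

end KaluzaKlein

end

/-! In a frame whose metric products are constant, the derivative terms of the Koszul formula
vanish, so the Levi-Civita connection is determined by the brackets of the frame fields
(`IsLeviCivita.koszul`). The theorem thus reduces to computing the brackets of the adapted frame.

A tangent vector of P is determined by its images under dπ and ω (`IsConnectionForm.eq_of_eq`), so
each bracket is found from these two components. The bracket [e_i, e_j] projects to [X_i, X_j], and
its ω-part is minus the curvature, because ω(e_i) = 0 identically. The fields e_σ and e_i commute,
because horizontal lifts are G-invariant (`mlieBracket_infinitesimalAction_of_invariant`). Finally
[e_σ, e_β] = -I([b_σ, b_β]) (`mlieBracket_infinitesimalAction`); the sign appears because G acts on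
the left while the bracket of 𝔤 is that of left-invariant fields.

Apart from the ω-part of [e_i, e_j], these rest on the naturality of the bracket under related
fields (`mfderiv_mlieBracket_of_related`), applied to π, to the orbit maps and to the action map G ×
P → P. The sign is settled on G itself by expanding left-invariant fields in right-invariant ones,
with the matrix of Ad as coefficients. The same calculation differentiates Ad, and Ad-invariance of
K then makes the structure constants totally antisymmetric (`structureConstant_antisymm`), which
collapses the three purely vertical Koszul terms into one. -/

section AdaptedFrames

open Bundle Set Filter
open scoped Manifold ContDiff Topology

set_option linter.unusedSectionVars false

/-! ### Naturality of the Lie bracket under related vector fields. -/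

namespace VectorField

/-- The Lie bracket of vector fields on vector spaces is natural under maps relating them. -/
lemma fderiv_lieBracket_of_related {E F : Type*} [NormedAddCommGroup E] [NormedSpace ℝ E]
    [NormedAddCommGroup F] [NormedSpace ℝ F] {f : E → F} {V W : E → E} {V' W' : F → F} {x : E}
    (hf : ContDiffAt ℝ 2 f x)
    (hV : DifferentiableAt ℝ V x) (hW : DifferentiableAt ℝ W x)
    (hV' : DifferentiableAt ℝ V' (f x)) (hW' : DifferentiableAt ℝ W' (f x))
    (hVV' : ∀ᶠ y in 𝓝 x, fderiv ℝ f y (V y) = V' (f y))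
    (hWW' : ∀ᶠ y in 𝓝 x, fderiv ℝ f y (W y) = W' (f y)) :
    fderiv ℝ f x (lieBracket ℝ V W x) = lieBracket ℝ V' W' (f x) := by
  have hf' : DifferentiableAt ℝ f x := hf.differentiableAt two_ne_zero
  -- The second derivative of `f` is symmetric, so its contributions cancel in the bracket. This is
  -- where C² is needed.
  rw [fderiv_apply_lieBracket hf (by simp) hW hV, EventuallyEq.fderiv_eq hVV',
    EventuallyEq.fderiv_eq hWW']
  have h1 := fderiv_comp x hW' hf'
  have h2 := fderiv_comp x hV' hf'
  simp only [Function.comp_def] at h1 h2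
  rw [h1, h2, lieBracket, ContinuousLinearMap.comp_apply, ContinuousLinearMap.comp_apply,
    hVV'.self_of_nhds, hWW'.self_of_nhds]

variable {E : Type*} [NormedAddCommGroup E] [NormedSpace ℝ E] [CompleteSpace E]
  {H : Type*} [TopologicalSpace H] {I : ModelWithCorners ℝ E H} [I.Boundaryless]
  {M : Type*} [TopologicalSpace M] [ChartedSpace H M] [IsManifold I 2 M]
  {E' : Type*} [NormedAddCommGroup E'] [NormedSpace ℝ E'] [CompleteSpace E']
  {H' : Type*} [TopologicalSpace H'] {I' : ModelWithCorners ℝ E' H'} [I'.Boundaryless]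
  {M' : Type*} [TopologicalSpace M'] [ChartedSpace H' M'] [IsManifold I' 2 M']

/-- The Lie bracket of vector fields, computed in the preferred chart. -/
lemma mlieBracket_eq_lieBracket_extChartAt (V W : Π x : M, TangentSpace I x) (x : M) :
    (mlieBracket I V W x : E) =
      lieBracket ℝ (mpullbackWithin 𝓘(ℝ, E) I (extChartAt I x).symm V (range I))
        (mpullbackWithin 𝓘(ℝ, E) I (extChartAt I x).symm W (range I)) (extChartAt I x x) := by
  rw [← mlieBracketWithin_univ, mlieBracketWithin_apply, mfderiv_extChartAt_self]
  have h1 : (ContinuousLinearMap.id ℝ (TangentSpace I x)).inverse =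
    ContinuousLinearMap.id ℝ (TangentSpace I x) := ContinuousLinearMap.inverse_id
  refine (DFunLike.congr_fun h1 _).trans ?_
  -- Without boundary the model range is the whole space, so the bracket within it is the plain
  -- bracket.
  have hs : (extChartAt I x).symm ⁻¹' univ ∩ range I = univ := by
    rw [preimage_univ, I.range_eq_univ, inter_self]
  exact (congrArg (fun s ↦ lieBracketWithin ℝ _ _ s (extChartAt I x x)) hs).trans
    (congrFun lieBracketWithin_univ _)

lemma _root_.MDifferentiableAt.differentiableAt_mpullbackWithin_extChartAt
    {V : Π x : M, TangentSpace I x} {x : M} (hV : MDiffAt (T% V) x) :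
    DifferentiableAt ℝ (mpullbackWithin 𝓘(ℝ, E) I (extChartAt I x).symm V (range I))
      (extChartAt I x x) :=
  (hV.mdifferentiableWithinAt (s := univ)).differentiableWithinAt_mpullbackWithin_vectorField
    |>.differentiableAt (by simp [I.range_eq_univ])

/-- The Lie bracket of vector fields is natural under maps relating them. -/
lemma mfderiv_mlieBracket_of_related {f : M → M'} {V W : Π x : M, TangentSpace I x}
    {V' W' : Π x : M', TangentSpace I' x} {x : M}
    (hf : ContMDiffAt I I' 2 f x)
    (hV : MDiffAt (T% V) x) (hW : MDiffAt (T% W) x)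
    (hV' : MDiffAt (T% V') (f x)) (hW' : MDiffAt (T% W') (f x))
    (hVV' : ∀ᶠ y in 𝓝 x, mfderiv I I' f y (V y) = V' (f y))
    (hWW' : ∀ᶠ y in 𝓝 x, mfderiv I I' f y (W y) = W' (f y)) :
    mfderiv I I' f x (mlieBracket I V W x) = mlieBracket I' V' W' (f x) := by
  set φ := extChartAt I x with hφ
  set ψ := extChartAt I' (f x) with hψ
  set F : E → E' := ψ ∘ f ∘ φ.symm with hF
  have hr : range I = univ := I.range_eq_univ
  have hr' : range I' = univ := I'.range_eq_univ
  have hFx : F (φ x) = ψ (f x) := by simp [hF, hφ]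
  -- Relatedness passes to charts: the coordinate representatives of `Y` and `Y'` are related by
  -- `F`, since pulling back along an inverse chart is applying the derivative of the chart.
  have key (Y : Π x : M, TangentSpace I x) (Y' : Π x : M', TangentSpace I' x)
      (h : ∀ᶠ y in 𝓝 x, mfderiv I I' f y (Y y) = Y' (f y)) :
      ∀ᶠ z in 𝓝 (φ x), fderiv ℝ F z (mpullbackWithin 𝓘(ℝ, E) I φ.symm Y (range I) z) =
        mpullbackWithin 𝓘(ℝ, E') I' ψ.symm Y' (range I') (F z) := by
    have hf1 : ∀ᶠ y in 𝓝 x, MDiffAt f y :=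
      ((contMDiffAt_iff_contMDiffAt_nhds (by simp)).1 hf |>.mono fun y hy ↦ hy.mdifferentiableAt two_ne_zero)
    have hf2 : ∀ᶠ y in 𝓝 x, f y ∈ ψ.source :=
      hf.continuousAt.eventually (extChartAt_source_mem_nhds (f x))
    have ht : Tendsto φ.symm (𝓝 (φ x)) (𝓝 x) := by
      simpa [hφ] using (continuousAt_extChartAt_symm (I := I) x).tendsto
    filter_upwards [ht.eventually h, ht.eventually hf1, ht.eventually hf2,
      extChartAt_target_mem_nhds (I := I) x] with z hz1 hz2 hz3 hz4
    have hz5 : f (φ.symm z) ∈ (chartAt H' (f x)).source := by simpa [hψ] using hz3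
    have hzs : φ.symm z ∈ φ.source := φ.map_target hz4
    have hsymm : MDiffAt φ.symm z := by
      simpa [-extChartAt, hr, mdifferentiableWithinAt_univ] using
        mdifferentiableWithinAt_extChartAt_symm hz4
    have e1 : fderiv ℝ F z = (mfderiv I' 𝓘(ℝ, E') ψ (f (φ.symm z))) ∘L
        (mfderiv I I' f (φ.symm z)) ∘L (mfderiv 𝓘(ℝ, E) I φ.symm z) := by
      rw [← mfderiv_eq_fderiv, hF, mfderiv_comp z (I' := I') (mdifferentiableAt_extChartAt hz5)
        (hz2.comp z hsymm), mfderiv_comp z hz2 hsymm]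
      rfl
    have i1 := isInvertible_mfderivWithin_extChartAt_symm (I := I) hz4
    have i2 := mfderivWithin_extChartAt_symm_comp_mfderiv_extChartAt' (I := I') hz3
    have i3 := isInvertible_mfderivWithin_extChartAt_symm (I := I') (ψ.map_source hz3)
    have hY' : (Y' (ψ.symm (F z)) : E') = Y' (f (φ.symm z)) := by
      have : ψ.symm (F z) = f (φ.symm z) := ψ.left_inv hz3
      rw [this]
    have hY : mfderiv 𝓘(ℝ, E) I φ.symm z
        ((mfderivWithin 𝓘(ℝ, E) I φ.symm (range I) z).inverse (Y (φ.symm z))) = Y (φ.symm z) := by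
      rw [← mfderivWithin_univ, ← hr]
      exact (i1.inverse_apply_eq.1 rfl).symm
    have e3 (u : E) : fderiv ℝ F z u = mfderiv I' 𝓘(ℝ, E') ψ (f (φ.symm z))
        (mfderiv I I' f (φ.symm z) (mfderiv 𝓘(ℝ, E) I φ.symm z u)) := DFunLike.congr_fun e1 u
    refine (e3 _).trans (Eq.trans ?_ (Eq.symm ((i3.inverse_apply_eq
      (x := mfderiv I' 𝓘(ℝ, E') ψ (f (φ.symm z)) (Y' (f (φ.symm z))))).2 ?_)))
    · exact congrArg _ ((congrArg _ hY).trans hz1)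
    · exact hY'.trans (DFunLike.congr_fun i2 (Y' (f (φ.symm z)))).symm
  have main := fderiv_lieBracket_of_related (f := F) (x := φ x)
    (V := mpullbackWithin 𝓘(ℝ, E) I φ.symm V (range I))
    (W := mpullbackWithin 𝓘(ℝ, E) I φ.symm W (range I))
    (V' := mpullbackWithin 𝓘(ℝ, E') I' ψ.symm V' (range I'))
    (W' := mpullbackWithin 𝓘(ℝ, E') I' ψ.symm W' (range I'))
    ?_ ?_ ?_ ?_ ?_ (key V V' hVV') (key W W' hWW')
  · have e2 : (mfderiv I I' f x : E →L[ℝ] E') = fderiv ℝ F (φ x) := by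
      refine (hf.mdifferentiableAt two_ne_zero).mfderiv.trans ?_
      rw [hr, fderivWithin_univ]
      rfl
    refine (congrArg (mfderiv I I' f x) (mlieBracket_eq_lieBracket_extChartAt V W x)).trans ?_
    refine (DFunLike.congr_fun e2 _).trans (main.trans ?_)
    rw [hFx]
    exact (mlieBracket_eq_lieBracket_extChartAt V' W' (f x)).symm
  · rw [← contDiffWithinAt_univ, ← hr]
    exact (contMDiffAt_iff.1 hf).2
  · exact hV.differentiableAt_mpullbackWithin_extChartAt
  · exact hW.differentiableAt_mpullbackWithin_extChartAt
  · rw [hFx]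
    exact hV'.differentiableAt_mpullbackWithin_extChartAt
  · rw [hFx]
    exact hW'.differentiableAt_mpullbackWithin_extChartAt

end VectorField

namespace KaluzaKlein

open VectorField

/-- The chain rule, with all tangent vectors seen in the model vector spaces. -/
lemma mfderiv_apply_of_eq_comp {E E' E'' H H' H'' : Type*}
    [NormedAddCommGroup E] [NormedSpace ℝ E] [TopologicalSpace H] {I : ModelWithCorners ℝ E H}
    [NormedAddCommGroup E'] [NormedSpace ℝ E'] [TopologicalSpace H'] {I' : ModelWithCorners ℝ E' H'}
    [NormedAddCommGroup E''] [NormedSpace ℝ E''] [TopologicalSpace H'']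
    {I'' : ModelWithCorners ℝ E'' H''} {M M' M'' : Type*}
    [TopologicalSpace M] [ChartedSpace H M] [TopologicalSpace M'] [ChartedSpace H' M']
    [TopologicalSpace M''] [ChartedSpace H'' M'']
    {f : M → M'} {g : M' → M''} {h : M → M''} {x : M} {y : M'}
    (hg : MDifferentiableAt I' I'' g y) (hf : MDifferentiableAt I I' f x)
    (hy : f x = y) (hh : ∀ z, h z = g (f z)) (v : E) :
    (mfderiv I I'' h x : E →L[ℝ] E'') v =
      (mfderiv I' I'' g y : E' →L[ℝ] E'') ((mfderiv I I' f x : E →L[ℝ] E') v) := by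
  subst hy
  obtain rfl : h = g ∘ f := funext hh
  exact DFunLike.congr_fun (mfderiv_comp x hg hf) v

/-! ### Generators of a smooth left action. -/

section Action

variable {EG EP : Type*} [NormedAddCommGroup EG] [NormedSpace ℝ EG]
  [NormedAddCommGroup EP] [NormedSpace ℝ EP]
  {G P : Type*} [TopologicalSpace G] [ChartedSpace EG G] [Group G] [LieGroup 𝓘(ℝ, EG) ∞ G]
  [TopologicalSpace P] [ChartedSpace EP P] [IsManifold 𝓘(ℝ, EP) ∞ P] [MulAction G P]
  [ContMDiffSMul 𝓘(ℝ, EG) 𝓘(ℝ, EP) ∞ G P]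

lemma contMDiff_smul_const (p : P) :
    ContMDiff 𝓘(ℝ, EG) 𝓘(ℝ, EP) ∞ (fun g : G ↦ g • p) :=
  contMDiff_id.smul contMDiff_const

/-- The derivative of the action map `G × P → P`. -/
lemma mfderiv_smul_prod (g : G) (p : P) (u : TangentSpace 𝓘(ℝ, EG) g)
    (v : TangentSpace 𝓘(ℝ, EP) p) :
    (mfderiv (𝓘(ℝ, EG).prod 𝓘(ℝ, EP)) 𝓘(ℝ, EP) (fun x : G × P ↦ x.1 • x.2) (g, p)
      ((u, v) : EG × EP) : EP) =
    (mfderiv 𝓘(ℝ, EG) 𝓘(ℝ, EP) (fun h : G ↦ h • p) g u : EP) +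
      (mfderiv 𝓘(ℝ, EP) 𝓘(ℝ, EP) (fun q : P ↦ g • q) p v : EP) :=
  mfderiv_prod_eq_add_apply (p := (g, p)) (v := ((u, v) : EG × EP))
    ((contMDiff_smul (n := ∞)).mdifferentiable (by simp) (g, p))

/-- The generators of an action are smooth vector fields. -/
lemma contMDiff_infinitesimalAction (X : GroupLieAlgebra 𝓘(ℝ, EG) G) :
    ContMDiff 𝓘(ℝ, EP) 𝓘(ℝ, EP).tangent ∞
      (fun p : P ↦ (⟨p, infinitesimalAction EG EP G p X⟩ : TangentBundle 𝓘(ℝ, EP) P)) := by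
  -- The generator at p is the derivative of the action map at (1, p) applied to (X, 0), so it is a
  -- composite of smooth maps ending in a tangent map.
  let F₁ : P → TangentBundle 𝓘(ℝ, EG) G × TangentBundle 𝓘(ℝ, EP) P :=
    fun p ↦ (⟨1, X⟩, ⟨p, 0⟩)
  have S₁ : ContMDiff 𝓘(ℝ, EP) (𝓘(ℝ, EG).tangent.prod 𝓘(ℝ, EP).tangent) ∞ F₁ :=
    contMDiff_const.prodMk (contMDiff_zeroSection _ _)
  have S₂ : ContMDiff (𝓘(ℝ, EG).tangent.prod 𝓘(ℝ, EP).tangent)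
      (𝓘(ℝ, EG).prod 𝓘(ℝ, EP)).tangent ∞
      (equivTangentBundleProd 𝓘(ℝ, EG) G 𝓘(ℝ, EP) P).symm := contMDiff_equivTangentBundleProd_symm
  have S₃ : ContMDiff (𝓘(ℝ, EG).prod 𝓘(ℝ, EP)).tangent 𝓘(ℝ, EP).tangent ∞
      (tangentMap (𝓘(ℝ, EG).prod 𝓘(ℝ, EP)) 𝓘(ℝ, EP) (fun x : G × P ↦ x.1 • x.2)) :=
    ContMDiff.contMDiff_tangentMap (n := ∞)
      (contMDiff_smul (I := 𝓘(ℝ, EG)) (I' := 𝓘(ℝ, EP)) (n := ∞)) (by simp)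
  refine ((S₃.comp S₂).comp S₁).congr fun p ↦ ?_
  have h := mfderiv_smul_prod (EG := EG) (EP := EP) (1 : G) p X 0
  rw [map_zero] at h
  refine TotalSpace.ext (one_smul G p).symm (heq_of_eq ?_)
  exact ((h.trans (add_zero _))).symm

/-- The generators of the left action of a Lie group on itself are related to those of an action
of the group by the orbit maps. -/
lemma mfderiv_orbit_infinitesimalAction (g : G) (p : P) (X : GroupLieAlgebra 𝓘(ℝ, EG) G) :
    mfderiv 𝓘(ℝ, EG) 𝓘(ℝ, EP) (fun h : G ↦ h • p) g (infinitesimalAction EG EG G g X) =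
      infinitesimalAction EG EP G (g • p) X := by
  exact (mfderiv_apply_of_eq_comp (h := fun a : G ↦ a • (g • p))
    ((contMDiff_smul_const (EP := EP) (EG := EG) p).mdifferentiable (by simp) g)
    ((contMDiff_smul_const (EP := EG) (EG := EG) g).mdifferentiable (by simp) (1 : G))
    (one_smul G g) (fun a ↦ by simp [mul_smul]) X).symm

variable [CompleteSpace EG] [CompleteSpace EP]

/-- The generators of an action commute with the invariant vector fields. -/
lemma mlieBracket_infinitesimalAction_of_invariant (X : GroupLieAlgebra 𝓘(ℝ, EG) G)
    {V : ∀ p : P, TangentSpace 𝓘(ℝ, EP) p} {p : P} (hV : MDiffAt (T% V) p)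
    (hinv : ∀ (g : G) (q : P), mfderiv 𝓘(ℝ, EP) 𝓘(ℝ, EP) (fun q : P ↦ g • q) q (V q) = V (g • q)) :
    mlieBracket 𝓘(ℝ, EP) (fun q : P ↦ infinitesimalAction EG EP G q X) V p = 0 := by
  -- No flows are used. On G × P the field `A` lives on the first factor and `B` on the second, so
  -- they commute. The action map relates `A` to the generator and, by invariance, `B` to `V`;
  -- naturality carries the vanishing bracket to P.
  let A : ∀ x : G × P, TangentSpace (𝓘(ℝ, EG).prod 𝓘(ℝ, EP)) x :=
    fun x ↦ ((infinitesimalAction EG EG G x.1 X, 0) : EG × EP)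
  let B : ∀ x : G × P, TangentSpace (𝓘(ℝ, EG).prod 𝓘(ℝ, EP)) x :=
    fun x ↦ ((0, V x.2) : EG × EP)
  have hS := (contMDiff_equivTangentBundleProd_symm (I := 𝓘(ℝ, EG)) (M := G) (I' := 𝓘(ℝ, EP))
    (M' := P) (n := 1)).mdifferentiable one_ne_zero
  have hX := (contMDiff_infinitesimalAction (EP := EP) (P := P) X).mdifferentiable (by simp)
  have hXG := (contMDiff_infinitesimalAction (EP := EG) (P := G) X).mdifferentiable (by simp)
  have h0G : MDifferentiable 𝓘(ℝ, EG) 𝓘(ℝ, EG).tangent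
      (fun g : G ↦ (⟨g, 0⟩ : TangentBundle 𝓘(ℝ, EG) G)) :=
    (contMDiff_zeroSection (n := 1) ℝ _).mdifferentiable one_ne_zero
  have h0P : MDifferentiable 𝓘(ℝ, EP) 𝓘(ℝ, EP).tangent
      (fun p : P ↦ (⟨p, 0⟩ : TangentBundle 𝓘(ℝ, EP) P)) :=
    (contMDiff_zeroSection (n := 1) ℝ _).mdifferentiable one_ne_zero
  have hA : MDiffAt (T% A) ((1 : G), p) :=
    (hS _).comp ((1 : G), p)
      (((hXG 1).comp ((1 : G), p) mdifferentiableAt_fst).prodMk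
        ((h0P p).comp ((1 : G), p) mdifferentiableAt_snd))
  have hB : MDiffAt (T% B) ((1 : G), p) :=
    (hS _).comp ((1 : G), p)
      (((h0G 1).comp ((1 : G), p) mdifferentiableAt_fst).prodMk
        (hV.comp ((1 : G), p) mdifferentiableAt_snd))
  -- Each projection relates one of `A`, `B` to the zero field, so both components of their bracket
  -- vanish.
  have h1 := mfderiv_mlieBracket_of_related (f := Prod.fst) (V := A) (W := B) (x := ((1 : G), p))
    (V' := fun g ↦ infinitesimalAction EG EG G g X) (W' := 0)
    contMDiffAt_fst hA hB (hXG 1) (h0G 1) (.of_forall fun y ↦ by rw [mfderiv_fst]; rfl)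
    (.of_forall fun y ↦ by rw [mfderiv_fst]; rfl)
  have h2 := mfderiv_mlieBracket_of_related (f := Prod.snd) (V := A) (W := B) (x := ((1 : G), p))
    (V' := 0) (W' := V)
    contMDiffAt_snd hA hB (h0P p) hV (.of_forall fun y ↦ by rw [mfderiv_snd]; rfl)
    (.of_forall fun y ↦ by rw [mfderiv_snd]; rfl)
  have h3 : (mlieBracket (𝓘(ℝ, EG).prod 𝓘(ℝ, EP)) A B ((1 : G), p) : EG × EP) = 0 := by
    rw [mfderiv_fst, mlieBracket_zero_right] at h1
    rw [mfderiv_snd, mlieBracket_zero_left] at h2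
    exact Prod.ext h1 h2
  have hp : ((1 : G) • p) = p := one_smul G p
  have h4 := mfderiv_mlieBracket_of_related (f := fun x : G × P ↦ x.1 • x.2) (V := A) (W := B)
    (x := ((1 : G), p)) (V' := fun q ↦ infinitesimalAction EG EP G q X) (W' := V)
    ((contMDiff_smul (I := 𝓘(ℝ, EG)) (I' := 𝓘(ℝ, EP))).contMDiffAt) hA hB (hX _) (by simpa [hp] using hV)
    (.of_forall fun y ↦ (mfderiv_smul_prod y.1 y.2 _ _).trans
      ((congrArg₂ (fun u v : EP ↦ u + v) (mfderiv_orbit_infinitesimalAction y.1 y.2 X)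
        (map_zero _)).trans (add_zero _)))
    (.of_forall fun y ↦ (mfderiv_smul_prod y.1 y.2 _ _).trans
      ((congrArg₂ (fun u v : EP ↦ u + v) (map_zero _) (hinv y.1 y.2)).trans (zero_add _)))
  have h5 : mlieBracket 𝓘(ℝ, EP) (fun q : P ↦ infinitesimalAction EG EP G q X) V ((1 : G) • p) = 0 :=
    h4.symm.trans ((congrArg _ h3).trans (map_zero _))
  rwa [hp] at h5

end Action

end KaluzaKlein

/-! ### Leibniz and sum rules for finite combinations. -/

namespace VectorField

variable {E : Type*} [NormedAddCommGroup E] [NormedSpace ℝ E] [CompleteSpace E]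
  {H : Type*} [TopologicalSpace H] {I : ModelWithCorners ℝ E H}
  {M : Type*} [TopologicalSpace M] [ChartedSpace H M] [IsManifold I 2 M] [IsManifold I 1 M]

lemma mlieBracket_sum_smul_right {κ : Type*} (s : Finset κ) {V : Π x : M, TangentSpace I x}
    {f : κ → M → ℝ} {W : κ → Π x : M, TangentSpace I x} {x : M}
    (hf : ∀ k, MDiffAt (f k) x) (hW : ∀ k, MDiffAt (T% (W k)) x) :
    mlieBracket I V (fun y ↦ ∑ k ∈ s, f k y • W k y) x =
      ∑ k ∈ s, (mvfderiv I (f k) x (V x) • W k x + f k x • mlieBracket I V (W k) x) := by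
  classical
  induction s using Finset.induction_on with
  | empty =>
    simp only [Finset.sum_empty]
    exact congrFun (mlieBracket_zero_right (I := I) (W := V)) x
  | insert k s hk ih =>
    rw [Finset.sum_insert hk, ← ih, ← mlieBracket_smul_right (hf k) (hW k), ← mlieBracket_add_right]
    · congr 1
      ext y
      simp [Finset.sum_insert hk]
    · exact (hf k).smul_section (hW k)
    · exact MDifferentiableAt.sum_section fun i _ ↦ (hf i).smul_section (hW i)

end VectorField

lemma mvfderiv_fun_sum {E : Type*} [NormedAddCommGroup E] [NormedSpace ℝ E]
    {H : Type*} [TopologicalSpace H] {I : ModelWithCorners ℝ E H}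
    {M : Type*} [TopologicalSpace M] [ChartedSpace H M] {κ : Type*} (s : Finset κ)
    {f : κ → M → ℝ} {x : M} (hf : ∀ k, MDiffAt (f k) x) :
    MDiffAt (fun y ↦ ∑ k ∈ s, f k y) x ∧
      mvfderiv I (fun y ↦ ∑ k ∈ s, f k y) x = ∑ k ∈ s, mvfderiv I (f k) x := by
  classical
  induction s using Finset.induction_on with
  | empty => exact ⟨mdifferentiableAt_const, by simpa using mvfderiv_const (I := I) (0 : ℝ)⟩
  | insert k s hk ih =>
    simp only [Finset.sum_insert hk]
    exact ⟨(hf k).add ih.1, by rw [mvfderiv_fun_add (hf k) ih.1, ih.2]⟩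

namespace KaluzaKlein

open VectorField

lemma mfderiv_apply_of_forall_eq {E H M : Type*} [NormedAddCommGroup E] [NormedSpace ℝ E]
    [TopologicalSpace H] {I : ModelWithCorners ℝ E H} [TopologicalSpace M] [ChartedSpace H M]
    {f : M → M} (hf : ∀ x, f x = x) (x : M) (v : E) :
    (mfderiv I I f x : E →L[ℝ] E) v = v := by
  obtain rfl : f = id := funext hf
  exact DFunLike.congr_fun (mfderiv_id (I := I) (x := x)) v

/-! ### The derivative of Ad, and left- versus right-invariant fields on G. -/

section Adjoint

variable {EG : Type*} [NormedAddCommGroup EG] [NormedSpace ℝ EG]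
  {G : Type*} [TopologicalSpace G] [ChartedSpace EG G] [Group G] [LieGroup 𝓘(ℝ, EG) ∞ G]

/-- Left translation is conjugation followed by right translation: g a = (g a g⁻¹) g. The generators
of left multiplication are the right-invariant fields. -/
lemma mulInvariantVectorField_eq_infinitesimalAction (X : GroupLieAlgebra 𝓘(ℝ, EG) G) (g : G) :
    mulInvariantVectorField X g = infinitesimalAction EG EG G g (Ad g X) :=
  mfderiv_apply_of_eq_comp (h := fun a : G ↦ g * a) (f := fun a : G ↦ g * a * g⁻¹)
    (g := fun a : G ↦ a • g) (y := 1)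
    ((contMDiff_smul_const (EP := EG) (EG := EG) g).mdifferentiable (by simp) (1 : G))
    ((contMDiff_mul_left.mul contMDiff_const : ContMDiff 𝓘(ℝ, EG) 𝓘(ℝ, EG) ∞ _).mdifferentiable
      (by simp) (1 : G)) (by simp) (fun a ↦ by simp) X

lemma infinitesimalAction_one (X : GroupLieAlgebra 𝓘(ℝ, EG) G) :
    infinitesimalAction EG EG G (1 : G) X = X :=
  mfderiv_apply_of_forall_eq (E := EG) (f := fun a : G ↦ a • (1 : G)) (by simp) (1 : G) X

lemma mulInvariantVectorField_one (X : GroupLieAlgebra 𝓘(ℝ, EG) G) :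
    mulInvariantVectorField X (1 : G) = X :=
  mfderiv_apply_of_forall_eq (E := EG) (f := fun a : G ↦ 1 * a) (by simp) (1 : G) X

lemma Ad_one (X : GroupLieAlgebra 𝓘(ℝ, EG) G) : Ad (1 : G) X = X := by
  have := mulInvariantVectorField_eq_infinitesimalAction X (1 : G)
  rwa [mulInvariantVectorField_one, infinitesimalAction_one, eq_comm] at this

lemma mdifferentiable_mulInvariantVectorField_of_lieGroup (X : GroupLieAlgebra 𝓘(ℝ, EG) G) :
    MDifferentiable 𝓘(ℝ, EG) 𝓘(ℝ, EG).tangent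
      (fun g : G ↦ (⟨g, mulInvariantVectorField X g⟩ : TangentBundle 𝓘(ℝ, EG) G)) :=
  haveI : LieGroup 𝓘(ℝ, EG) (minSmoothness ℝ 3) G := LieGroup.of_le (n := ∞) (by simpa using ENat.LEInfty.out)
  mdifferentiable_mulInvariantVectorField X

/-- `g ↦ Ad(g) X` is differentiable at the identity. -/
lemma mdifferentiableAt_Ad (X : GroupLieAlgebra 𝓘(ℝ, EG) G) :
    MDifferentiableAt (M' := EG) 𝓘(ℝ, EG) 𝓘(ℝ, EG) (fun g : G ↦ Ad g X) 1 := by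
  have hS := (contMDiff_equivTangentBundleProd_symm (I := 𝓘(ℝ, EG)) (M := G) (I' := 𝓘(ℝ, EG))
    (M' := G) (n := 1)).mdifferentiable one_ne_zero
  have h0 : MDifferentiable 𝓘(ℝ, EG) 𝓘(ℝ, EG).tangent
      (fun g : G ↦ (⟨g, 0⟩ : TangentBundle 𝓘(ℝ, EG) G)) :=
    (contMDiff_zeroSection (n := 1) ℝ _).mdifferentiable one_ne_zero
  have hinv : MDifferentiable 𝓘(ℝ, EG) 𝓘(ℝ, EG) (fun g : G ↦ g⁻¹) :=
    (contMDiff_inv 𝓘(ℝ, EG) ∞).mdifferentiable (by simp)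
  have hT : MDifferentiable (𝓘(ℝ, EG).prod 𝓘(ℝ, EG)).tangent 𝓘(ℝ, EG).tangent
      (tangentMap (𝓘(ℝ, EG).prod 𝓘(ℝ, EG)) 𝓘(ℝ, EG) (fun x : G × G ↦ x.1 • x.2)) :=
    (ContMDiff.contMDiff_tangentMap (n := ∞) (m := 1)
      (contMDiff_smul (I := 𝓘(ℝ, EG)) (I' := 𝓘(ℝ, EG)) (n := ∞))
        (by norm_cast)).mdifferentiable one_ne_zero
  -- Ad(g) X is the derivative of multiplication at (g, g⁻¹) applied to the left-invariant field of
  -- X in the first slot and zero in the second.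
  have h1 : MDifferentiableAt 𝓘(ℝ, EG) 𝓘(ℝ, EG).tangent
      (fun g : G ↦ (⟨1, Ad g X⟩ : TangentBundle 𝓘(ℝ, EG) G)) 1 := by
    refine (((hT _).comp (1 : G) ((hS _).comp (1 : G) (((mdifferentiable_mulInvariantVectorField_of_lieGroup X 1)).prodMk
      ((h0 _).comp (1 : G) (hinv 1))))).congr_of_eventuallyEq (.of_forall fun g ↦ ?_))
    refine TotalSpace.ext (mul_inv_cancel g).symm (heq_of_eq ?_)
    have h2 := mfderiv_smul_prod (EG := EG) (EP := EG) g g⁻¹ (mulInvariantVectorField X g) 0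
    rw [map_zero] at h2
    refine Eq.trans ?_ ((h2.trans (add_zero _))).symm
    exact mfderiv_apply_of_eq_comp (h := fun a : G ↦ g * a * g⁻¹) (f := fun a : G ↦ g * a)
      (g := fun a : G ↦ a • g⁻¹) (y := g)
      ((contMDiff_smul_const (EP := EG) (EG := EG) g⁻¹).mdifferentiable (by simp) g)
      ((contMDiff_mul_left : ContMDiff 𝓘(ℝ, EG) 𝓘(ℝ, EG) ∞ _).mdifferentiable
        (by simp) (1 : G)) (by simp) (fun a ↦ by simp) X
  -- The base point stays at 1, where the trivialization centred at 1 is the identity on the fibre.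
  -- The fibre coordinate of the section is therefore Ad(g) X itself.
  refine ((mdifferentiableAt_totalSpace _ _).1 h1).2.congr_of_eventuallyEq (.of_forall fun g ↦ ?_)
  exact (DFunLike.congr_fun (fderivWithin_extChartAt_comp_extChartAt_symm_range
    (I := 𝓘(ℝ, EG)) (x := (1 : G))) (Ad g X)).symm

variable [FiniteDimensional ℝ EG] {κ : Type*} [Fintype κ]

lemma mdifferentiableAt_repr_Ad (b : Module.Basis κ ℝ (GroupLieAlgebra 𝓘(ℝ, EG) G))
    (X : GroupLieAlgebra 𝓘(ℝ, EG) G) (k : κ) :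
    MDifferentiableAt 𝓘(ℝ, EG) 𝓘(ℝ, ℝ) (fun g : G ↦ b.repr (Ad g X) k) 1 := by
  let ℓ : EG →ₗ[ℝ] ℝ := b.coord k
  exact (ℓ.toContinuousLinearMap.differentiable _).comp_mdifferentiableAt (mdifferentiableAt_Ad X)

/-- The right-invariant fields form a global frame in which a left-invariant field has the entries
of Ad as coefficients. The Leibniz rule then converts brackets into derivatives of Ad. -/
lemma mulInvariantVectorField_eq_sum (b : Module.Basis κ ℝ (GroupLieAlgebra 𝓘(ℝ, EG) G))
    (X : GroupLieAlgebra 𝓘(ℝ, EG) G) :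
    mulInvariantVectorField X =
      fun g : G ↦ ∑ k, b.repr (Ad g X) k • infinitesimalAction EG EG G g (b k) := by
  ext g
  rw [mulInvariantVectorField_eq_infinitesimalAction]
  conv_lhs => rw [← b.sum_repr (Ad g X)]
  rw [map_sum]
  exact Finset.sum_congr rfl fun k _ ↦ map_smul _ _ _

variable [CompleteSpace EG]

/-- Left and right translations commute: a left-invariant field is an invariant field for the action
of G on itself. -/
lemma mlieBracket_infinitesimalAction_mulInvariantVectorField
    (X Y : GroupLieAlgebra 𝓘(ℝ, EG) G) (g : G) :
    mlieBracket 𝓘(ℝ, EG) (fun g : G ↦ infinitesimalAction EG EG G g X)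
      (mulInvariantVectorField Y) g = 0 :=
  mlieBracket_infinitesimalAction_of_invariant X
    (mdifferentiable_mulInvariantVectorField_of_lieGroup Y g) fun a q ↦
      (mfderiv_apply_of_eq_comp (h := fun c : G ↦ (a * q) * c) (f := fun c : G ↦ q * c)
        (g := fun c : G ↦ a • c) (y := q)
        ((contMDiff_mul_left : ContMDiff 𝓘(ℝ, EG) 𝓘(ℝ, EG) ∞ _).mdifferentiable (by simp) q)
        ((contMDiff_mul_left : ContMDiff 𝓘(ℝ, EG) 𝓘(ℝ, EG) ∞ _).mdifferentiable (by simp) (1 : G))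
        (by simp) (fun c ↦ by simp [mul_assoc]) Y).symm

lemma mlieBracket_mulInvariantVectorField_one_eq_sum {κ : Type*} [Fintype κ]
    (b : Module.Basis κ ℝ (GroupLieAlgebra 𝓘(ℝ, EG) G))
    (V : ∀ g : G, TangentSpace 𝓘(ℝ, EG) g) (X : GroupLieAlgebra 𝓘(ℝ, EG) G) :
    mlieBracket 𝓘(ℝ, EG) V (mulInvariantVectorField X) (1 : G) =
      ∑ k, mvfderiv 𝓘(ℝ, EG) (fun g : G ↦ b.repr (Ad g X) k) 1 (V 1) • b k +
        ∑ k, b.repr X k •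
          mlieBracket 𝓘(ℝ, EG) V (fun g : G ↦ infinitesimalAction EG EG G g (b k)) 1 := by
  rw [mulInvariantVectorField_eq_sum b, mlieBracket_sum_smul_right _
    (mdifferentiableAt_repr_Ad b X) fun k ↦
      (contMDiff_infinitesimalAction (EP := EG) (P := G) (b k)).mdifferentiable (by simp) 1,
    Finset.sum_add_distrib]
  simp only [infinitesimalAction_one, Ad_one]

lemma mlieBracket_infinitesimalAction_eq_sum {κ : Type*} [Fintype κ]
    (b : Module.Basis κ ℝ (GroupLieAlgebra 𝓘(ℝ, EG) G))
    (V : ∀ g : G, TangentSpace 𝓘(ℝ, EG) g) (X : GroupLieAlgebra 𝓘(ℝ, EG) G) :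
    mlieBracket 𝓘(ℝ, EG) V (fun g : G ↦ infinitesimalAction EG EG G g X) 1 =
      ∑ k, b.repr X k •
        mlieBracket 𝓘(ℝ, EG) V (fun g : G ↦ infinitesimalAction EG EG G g (b k)) 1 := by
  have h : (fun g : G ↦ infinitesimalAction EG EG G g X) =
      fun g : G ↦ ∑ k, b.repr X k • infinitesimalAction EG EG G g (b k) := by
    ext g
    conv_lhs => rw [← b.sum_repr X]
    rw [map_sum]
    exact Finset.sum_congr rfl fun k _ ↦ map_smul _ _ _
  rw [h, mlieBracket_sum_smul_right (f := fun k _ ↦ b.repr X k) _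
    (fun k ↦ mdifferentiableAt_const) fun k ↦
      (contMDiff_infinitesimalAction (EP := EG) (P := G) (b k)).mdifferentiable (by simp) 1]
  simp [mvfderiv_const]

/-- The derivative of `Ad` at the identity is minus the bracket of the generators of the left
action of the group on itself. -/
lemma sum_mvfderiv_repr_Ad (b : Module.Basis κ ℝ (GroupLieAlgebra 𝓘(ℝ, EG) G))
    (X Y : GroupLieAlgebra 𝓘(ℝ, EG) G) :
    ∑ k, mvfderiv 𝓘(ℝ, EG) (fun g : G ↦ b.repr (Ad g X) k) 1 Y • b k =
      - mlieBracket 𝓘(ℝ, EG) (fun g : G ↦ infinitesimalAction EG EG G g Y)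
        (fun g : G ↦ infinitesimalAction EG EG G g X) 1 := by
  have h := mlieBracket_mulInvariantVectorField_one_eq_sum b
    (fun g : G ↦ infinitesimalAction EG EG G g Y) X
  rw [mlieBracket_infinitesimalAction_mulInvariantVectorField,
    ← mlieBracket_infinitesimalAction_eq_sum, infinitesimalAction_one] at h
  exact eq_neg_of_add_eq_zero_left h.symm

/-- The bracket of the generators of the left action of a Lie group on itself. -/
lemma mlieBracket_infinitesimalAction_one (X Y : GroupLieAlgebra 𝓘(ℝ, EG) G) :
    mlieBracket 𝓘(ℝ, EG) (fun g : G ↦ infinitesimalAction EG EG G g X)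
        (fun g : G ↦ infinitesimalAction EG EG G g Y) 1 = - ⁅X, Y⁆ := by
  have : FiniteDimensional ℝ (GroupLieAlgebra 𝓘(ℝ, EG) G) :=
    inferInstanceAs (FiniteDimensional ℝ EG)
  let b := Module.finBasis ℝ (GroupLieAlgebra 𝓘(ℝ, EG) G)
  -- With a left-invariant field in the first slot the bracket terms of the expansion drop out. What
  -- remains is the derivative of Ad, already identified with minus the bracket of the generators,
  -- while the left side is the Lie algebra bracket by definition.
  have h := mlieBracket_mulInvariantVectorField_one_eq_sum b (mulInvariantVectorField X) Y
  rw [mulInvariantVectorField_one, sum_mvfderiv_repr_Ad] at h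
  simp_rw [mlieBracket_swap_apply (V := mulInvariantVectorField X)
    (W := fun g : G ↦ infinitesimalAction EG EG G g _),
    mlieBracket_infinitesimalAction_mulInvariantVectorField] at h
  rw [GroupLieAlgebra.bracket_def, h]
  simp

/-- The derivative of the adjoint representation is the bracket. -/
lemma mvfderiv_repr_Ad (b : Module.Basis κ ℝ (GroupLieAlgebra 𝓘(ℝ, EG) G))
    (X Y : GroupLieAlgebra 𝓘(ℝ, EG) G) (k : κ) :
    mvfderiv 𝓘(ℝ, EG) (fun g : G ↦ b.repr (Ad g X) k) 1 Y = b.repr ⁅Y, X⁆ k := by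
  classical
  have h := sum_mvfderiv_repr_Ad b X Y
  rw [mlieBracket_infinitesimalAction_one, neg_neg] at h
  rw [← h, b.repr_sum_self]

end Adjoint

/-! ### Brackets of generators on P, transported from G along orbit maps. -/

section

variable {EG EP : Type*} [NormedAddCommGroup EG] [NormedSpace ℝ EG] [FiniteDimensional ℝ EG]
  [NormedAddCommGroup EP] [NormedSpace ℝ EP] [CompleteSpace EP]
  {G P : Type*} [TopologicalSpace G] [ChartedSpace EG G] [Group G] [LieGroup 𝓘(ℝ, EG) ∞ G]
  [TopologicalSpace P] [ChartedSpace EP P] [IsManifold 𝓘(ℝ, EP) ∞ P] [MulAction G P]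
  [ContMDiffSMul 𝓘(ℝ, EG) 𝓘(ℝ, EP) ∞ G P]

/-- The bracket of the generators of a left action. -/
lemma mlieBracket_infinitesimalAction (X Y : GroupLieAlgebra 𝓘(ℝ, EG) G) (p : P) :
    mlieBracket 𝓘(ℝ, EP) (fun q : P ↦ infinitesimalAction EG EP G q X)
        (fun q : P ↦ infinitesimalAction EG EP G q Y) p =
      - infinitesimalAction EG EP G p ⁅X, Y⁆ := by
  have : CompleteSpace EG := FiniteDimensional.complete ℝ EG
  have hP (Z : GroupLieAlgebra 𝓘(ℝ, EG) G) :=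
    (contMDiff_infinitesimalAction (EP := EP) (P := P) Z).mdifferentiable (by simp)
  have hG (Z : GroupLieAlgebra 𝓘(ℝ, EG) G) :=
    (contMDiff_infinitesimalAction (EP := EG) (P := G) Z).mdifferentiable (by simp)
  have h := mfderiv_mlieBracket_of_related (f := fun g : G ↦ g • p) (x := (1 : G))
    (V := fun g : G ↦ infinitesimalAction EG EG G g X)
    (W := fun g : G ↦ infinitesimalAction EG EG G g Y)
    (V' := fun q : P ↦ infinitesimalAction EG EP G q X)
    (W' := fun q : P ↦ infinitesimalAction EG EP G q Y)
    (((contMDiff_smul_const (EG := EG) (EP := EP) p).of_le ENat.LEInfty.out) 1)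
    (hG X 1) (hG Y 1) (hP X _) (hP Y _)
    (.of_forall fun g ↦ mfderiv_orbit_infinitesimalAction g p X)
    (.of_forall fun g ↦ mfderiv_orbit_infinitesimalAction g p Y)
  rw [mlieBracket_infinitesimalAction_one, map_neg] at h
  have hp (q : P) (hq : q = p) (w : EP) (hw : mlieBracket 𝓘(ℝ, EP)
      (fun q : P ↦ infinitesimalAction EG EP G q X)
      (fun q : P ↦ infinitesimalAction EG EP G q Y) q = w) :
      mlieBracket 𝓘(ℝ, EP) (fun q : P ↦ infinitesimalAction EG EP G q X)
      (fun q : P ↦ infinitesimalAction EG EP G q Y) p = w := by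
    subst hq; exact hw
  exact hp _ (one_smul G p) _ h.symm

end

/-! ### Antisymmetry of the structure constants. -/

section

variable {EG : Type*} [NormedAddCommGroup EG] [NormedSpace ℝ EG] [FiniteDimensional ℝ EG]
  {G : Type*} [TopologicalSpace G] [ChartedSpace EG G] [Group G] [LieGroup 𝓘(ℝ, EG) ∞ G]
  {K : LinearMap.BilinForm ℝ (GroupLieAlgebra 𝓘(ℝ, EG) G)} {κ : Type*} [Fintype κ] [DecidableEq κ]
  {b : Module.Basis κ ℝ (GroupLieAlgebra 𝓘(ℝ, EG) G)}

lemma apply_orthonormalBasis_eq_repr (hb : ∀ σ β, K (b σ) (b β) = if σ = β then 1 else 0)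
    (X : GroupLieAlgebra 𝓘(ℝ, EG) G) (σ : κ) : K X (b σ) = b.repr X σ := by
  conv_lhs => rw [← b.sum_repr X]
  simp only [map_sum, map_smul, LinearMap.sum_apply, LinearMap.smul_apply, hb, smul_eq_mul,
    mul_ite, mul_one, mul_zero, Finset.sum_ite_eq', Finset.mem_univ, if_true]

lemma sum_repr_mul_repr (hb : ∀ σ β, K (b σ) (b β) = if σ = β then 1 else 0)
    (X Y : GroupLieAlgebra 𝓘(ℝ, EG) G) : K X Y = ∑ k, b.repr X k * b.repr Y k := by
  conv_lhs => rw [← b.sum_repr Y]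
  simp only [map_sum, map_smul, smul_eq_mul, apply_orthonormalBasis_eq_repr hb, mul_comm]

lemma structureConstant_swap (γ σ β : κ) :
    structureConstant b γ σ β = - structureConstant b γ β σ := by
  rw [structureConstant, structureConstant, GroupLieAlgebra.bracket_def,
    GroupLieAlgebra.bracket_def, mlieBracket_swap_apply]
  simp

/-- The structure constants in an orthonormal basis for an `Ad`-invariant inner product are
antisymmetric. -/
lemma structureConstant_antisymm (hK : IsAdInvariantInnerProduct K)
    (hb : ∀ σ β, K (b σ) (b β) = if σ = β then 1 else 0) (γ σ β : κ) :
    structureConstant b γ σ β = - structureConstant b β σ γ := by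
  -- The sum is K(Ad(g) b_β, Ad(g) b_γ), constant in g. Its derivative at 1 along b_σ is C^β_{σγ} +
  -- C^γ_{σβ}.
  have hconst : (fun g : G ↦ ∑ k, b.repr (Ad g (b β)) k * b.repr (Ad g (b γ)) k) =
      fun _ ↦ K (b β) (b γ) := by
    ext g
    rw [← sum_repr_mul_repr hb, hK.ad_invariant]
  have hd (X : GroupLieAlgebra 𝓘(ℝ, EG) G) (k : κ) := mdifferentiableAt_repr_Ad b X k
  have h := (mvfderiv_fun_sum (I := 𝓘(ℝ, EG)) Finset.univ fun k ↦ (hd (b β) k).mul (hd (b γ) k)).2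
  have h' : mvfderiv 𝓘(ℝ, EG) (fun g : G ↦ ∑ k, b.repr (Ad g (b β)) k * b.repr (Ad g (b γ)) k) 1
      (b σ) = 0 := by
    rw [hconst, mvfderiv_const]; rfl
  have h'' := (DFunLike.congr_fun h (b σ)).symm.trans h'
  have hmul (k : κ) := DFunLike.congr_fun (mvfderiv_mul (hd (b β) k) (hd (b γ) k)) (b σ)
  rw [_root_.sum_apply] at h''
  simp only [hmul, _root_.add_apply, _root_.smul_apply,
    mvfderiv_repr_Ad, Ad_one, Finset.sum_add_distrib, b.repr_self, smul_eq_mul] at h''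
  simp only [Finsupp.single_apply, ite_mul, one_mul, zero_mul, Finset.sum_ite_eq,
    Finset.mem_univ, if_true] at h''
  exact eq_neg_of_add_eq_zero_right h''

end

/-! ### The splitting of TP and horizontal lifts. -/

section Bundle

variable {EM EG EP : Type*}
  [NormedAddCommGroup EM] [NormedSpace ℝ EM] [FiniteDimensional ℝ EM]
  [NormedAddCommGroup EG] [NormedSpace ℝ EG] [FiniteDimensional ℝ EG]
  [NormedAddCommGroup EP] [NormedSpace ℝ EP] [FiniteDimensional ℝ EP]
  {M G P : Type*}
  [TopologicalSpace M] [ChartedSpace EM M] [IsManifold 𝓘(ℝ, EM) ∞ M]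
  [TopologicalSpace G] [ChartedSpace EG G] [Group G] [LieGroup 𝓘(ℝ, EG) ∞ G]
  [TopologicalSpace P] [ChartedSpace EP P] [IsManifold 𝓘(ℝ, EP) ∞ P] [MulAction G P]
  {proj : P → M}

lemma IsPrincipalBundle.mdifferentiable_proj (hproj : IsPrincipalBundle EM EG EP G proj) :
    MDifferentiable 𝓘(ℝ, EP) 𝓘(ℝ, EM) proj :=
  hproj.contMDiff_proj.mdifferentiable (by simp)

/-- Vertical vectors project to zero. -/
lemma IsPrincipalBundle.mfderiv_proj_infinitesimalAction
    (hproj : IsPrincipalBundle EM EG EP G proj) (p : P) (X : GroupLieAlgebra 𝓘(ℝ, EG) G) :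
    mfderiv 𝓘(ℝ, EP) 𝓘(ℝ, EM) proj p (infinitesimalAction EG EP G p X) = 0 := by
  have := hproj.contMDiff_smul
  have h := mfderiv_apply_of_eq_comp (h := fun _ : G ↦ proj p) (hproj.mdifferentiable_proj p)
    ((contMDiff_smul_const (EP := EP) (EG := EG) p).mdifferentiable (by simp) (1 : G))
    (one_smul G p) (fun g ↦ (hproj.proj_smul g p).symm) X
  rw [mfderiv_const] at h
  exact h.symm

/-- The projection of a principal bundle is a submersion, along which vector fields lift locally. -/
lemma IsPrincipalBundle.submersion (hproj : IsPrincipalBundle EM EG EP G proj) (p : P) :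
    Module.finrank ℝ EP = Module.finrank ℝ EM + Module.finrank ℝ EG ∧
    Function.Surjective (mfderiv 𝓘(ℝ, EP) 𝓘(ℝ, EM) proj p) ∧
    ∀ (X : ∀ x : M, TangentSpace 𝓘(ℝ, EM) x), CMDiffAt ∞ (T% X) (proj p) →
      ∃ V : ∀ q : P, TangentSpace 𝓘(ℝ, EP) q, CMDiffAt ∞ (T% V) p ∧
        ∀ᶠ q in 𝓝 p, mfderiv 𝓘(ℝ, EP) 𝓘(ℝ, EM) proj q (V q) = X (proj q) := by
  obtain ⟨U, φ, hU, hpU, hsource, htarget, hφ, hφs, hφ1, -⟩ := hproj.exists_trivialization (proj p)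
  have hp : p ∈ φ.source := by rw [hsource]; exact hpU
  have hd : φ.MDifferentiable 𝓘(ℝ, EP) (𝓘(ℝ, EM).prod 𝓘(ℝ, EG)) :=
    ⟨hφ.mdifferentiableOn (by simp), hφs.mdifferentiableOn (by simp)⟩
  have hpr (q : P) (hq : q ∈ φ.source) (v : EP) :
      (mfderiv 𝓘(ℝ, EP) 𝓘(ℝ, EM) proj q : EP →L[ℝ] EM) v =
        ((mfderiv 𝓘(ℝ, EP) (𝓘(ℝ, EM).prod 𝓘(ℝ, EG)) φ q : EP →L[ℝ] EM × EG) v).1 := by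
    have h1 : proj =ᶠ[𝓝 q] Prod.fst ∘ φ :=
      eventually_of_mem (φ.open_source.mem_nhds hq) fun r hr ↦ (hφ1 r hr).symm
    have h2 : (mfderiv 𝓘(ℝ, EP) 𝓘(ℝ, EM) proj q : EP →L[ℝ] EM) =
      (mfderiv 𝓘(ℝ, EP) 𝓘(ℝ, EM) (Prod.fst ∘ φ) q : EP →L[ℝ] EM) := h1.mfderiv_eq
    have h3 := mfderiv_apply_of_eq_comp (h := Prod.fst ∘ φ) (f := φ) (g := Prod.fst) (x := q)
      (I'' := 𝓘(ℝ, EM)) mdifferentiableAt_fst (hd.mdifferentiableAt hq) rfl (fun _ ↦ rfl) v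
    rw [mfderiv_fst] at h3
    exact (DFunLike.congr_fun h2 v).trans h3
  refine ⟨?_, fun v ↦ ?_, fun X hX ↦ ?_⟩
  · let e : EP ≃L[ℝ] EM × EG := hd.mfderiv hp
    rw [e.toLinearEquiv.finrank_eq, Module.finrank_prod]
  · obtain ⟨u, hu⟩ := hd.mfderiv_surjective hp ((v, 0) : EM × EG)
    exact ⟨u, (hpr p hp u).trans (congrArg Prod.fst hu)⟩
  -- In a trivialization the field (X, 0) lifts X; pull it back to P.
  · let Y : ∀ x : M × G, TangentSpace (𝓘(ℝ, EM).prod 𝓘(ℝ, EG)) x :=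
      fun x ↦ ((X x.1, 0) : EM × EG)
    have hinv (q : P) (hq : q ∈ φ.source) :
        (mfderiv 𝓘(ℝ, EP) (𝓘(ℝ, EM).prod 𝓘(ℝ, EG)) φ q).IsInvertible := ⟨hd.mfderiv hq, rfl⟩
    have hXp : CMDiffAt ∞ (T% X) (φ p).1 := by rwa [hφ1 p hp]
    have hY : CMDiffAt ∞ (T% Y) (φ p) :=
      (contMDiff_equivTangentBundleProd_symm (I := 𝓘(ℝ, EM)) (M := M) (I' := 𝓘(ℝ, EG))
        (M' := G) (n := ∞) _).comp (φ p) ((hXp.comp (φ p) contMDiffAt_fst).prodMk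
          ((contMDiff_zeroSection (n := ∞) (IB := 𝓘(ℝ, EG)) ℝ
            (fun x : G ↦ TangentSpace 𝓘(ℝ, EG) x) _).comp (φ p) contMDiffAt_snd))
    refine ⟨mpullback 𝓘(ℝ, EP) (𝓘(ℝ, EM).prod 𝓘(ℝ, EG)) φ Y,
      hY.mpullback_vectorField_preimage (n := ∞) (hφ.contMDiffAt (φ.open_source.mem_nhds hp))
        (hinv p hp) (by simp), ?_⟩
    filter_upwards [φ.open_source.mem_nhds hp] with q hq
    refine (hpr q hq _).trans ?_
    have h1 : mfderiv 𝓘(ℝ, EP) (𝓘(ℝ, EM).prod 𝓘(ℝ, EG)) φ q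
        (mpullback 𝓘(ℝ, EP) (𝓘(ℝ, EM).prod 𝓘(ℝ, EG)) φ Y q) = Y (φ q) :=
      ((hinv q hq).inverse_apply_eq.1 rfl).symm
    refine (congrArg Prod.fst h1).trans ?_
    change (X (φ q).1 : EM) = X (proj q)
    rw [hφ1 q hq]

variable {conn : ∀ p : P, TangentSpace 𝓘(ℝ, EP) p →L[ℝ] GroupLieAlgebra 𝓘(ℝ, EG) G}

/-- A vector which is annihilated by `dπ` and by a connection form vanishes. -/
lemma IsConnectionForm.eq_zero (hproj : IsPrincipalBundle EM EG EP G proj)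
    (hconn : IsConnectionForm conn) {p : P} {u : TangentSpace 𝓘(ℝ, EP) p}
    (hu : conn p u = 0) (hu' : mfderiv 𝓘(ℝ, EP) 𝓘(ℝ, EM) proj p u = 0) : u = 0 := by
  let A' : EP →L[ℝ] EM := mfderiv 𝓘(ℝ, EP) 𝓘(ℝ, EM) proj p
  let B' : EG →L[ℝ] EP := infinitesimalAction EG EP G p
  let A : EP →ₗ[ℝ] EM := A'
  let B : EG →ₗ[ℝ] EP := B'
  obtain ⟨hdim, hsurj, -⟩ := hproj.submersion p
  have hA : LinearMap.range A = ⊤ := LinearMap.range_eq_top.2 hsurj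
  have hB : LinearMap.ker B = ⊥ := by
    refine LinearMap.ker_eq_bot'.2 fun X hX ↦ ?_
    have h : conn p (infinitesimalAction EG EP G p X) = X := hconn.apply_infinitesimalAction p X
    have h0 : infinitesimalAction EG EP G p X = 0 := hX
    rw [h0, map_zero] at h
    exact h.symm
  have hle : LinearMap.range B ≤ LinearMap.ker A := by
    rintro _ ⟨X, rfl⟩
    exact hproj.mfderiv_proj_infinitesimalAction p X
  have h1 := LinearMap.finrank_range_add_finrank_ker A
  have h2 := LinearMap.finrank_range_add_finrank_ker B
  rw [hA, finrank_top] at h1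
  rw [hB, finrank_bot] at h2
  -- By rank-nullity both spaces have the dimension of G, so every vector in ker dπ is vertical. On
  -- vertical vectors ω inverts I.
  have heq := Submodule.eq_of_le_of_finrank_eq hle (by omega)
  have hmem : (u : EP) ∈ LinearMap.range B := by rw [heq]; exact hu'
  obtain ⟨X, h3⟩ : ∃ X : GroupLieAlgebra 𝓘(ℝ, EG) G, infinitesimalAction EG EP G p X = u := hmem
  rw [← h3, hconn.apply_infinitesimalAction] at hu
  rw [← h3, hu, map_zero]

lemma IsConnectionForm.eq_of_eq (hproj : IsPrincipalBundle EM EG EP G proj)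
    (hconn : IsConnectionForm conn) {p : P} {u v : TangentSpace 𝓘(ℝ, EP) p}
    (h : conn p u = conn p v) (h' : mfderiv 𝓘(ℝ, EP) 𝓘(ℝ, EM) proj p u =
      mfderiv 𝓘(ℝ, EP) 𝓘(ℝ, EM) proj p v) : u = v :=
  sub_eq_zero.1 (hconn.eq_zero hproj (by rw [map_sub, h, sub_self]) (by rw [map_sub, h', sub_self]))

lemma IsConnectionForm.horizontalLift_spec (hproj : IsPrincipalBundle EM EG EP G proj)
    (hconn : IsConnectionForm conn) (p : P) (v : TangentSpace 𝓘(ℝ, EM) (proj p)) :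
    conn p (horizontalLift proj conn p v) = 0 ∧
      mfderiv 𝓘(ℝ, EP) 𝓘(ℝ, EM) proj p (horizontalLift proj conn p v) = v := by
  obtain ⟨u, hu⟩ := (hproj.submersion p).2.1 v
  refine Classical.epsilon_spec (p := fun u ↦ conn p u = 0 ∧ mfderiv 𝓘(ℝ, EP) 𝓘(ℝ, EM) proj p u = v)
    -- Removing the vertical part of any preimage makes it horizontal without changing its
    -- projection.
    ⟨u - infinitesimalAction EG EP G p (conn p u), ?_, ?_⟩
  · rw [map_sub, hconn.apply_infinitesimalAction, sub_self]
  · rw [map_sub, hproj.mfderiv_proj_infinitesimalAction, sub_zero, hu]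

/-- Horizontal lifts are invariant under the structure group. -/
lemma IsConnectionForm.mfderiv_smul_horizontalLift (hproj : IsPrincipalBundle EM EG EP G proj)
    (hconn : IsConnectionForm conn) (X : ∀ x : M, TangentSpace 𝓘(ℝ, EM) x) (g : G) (p : P) :
    mfderiv 𝓘(ℝ, EP) 𝓘(ℝ, EP) (fun q : P ↦ g • q) p (horizontalLift proj conn p (X (proj p))) =
      horizontalLift proj conn (g • p) (X (proj (g • p))) := by
  have := hproj.contMDiff_smul
  obtain ⟨h1, h2⟩ := hconn.horizontalLift_spec hproj p (X (proj p))
  obtain ⟨h3, h4⟩ := hconn.horizontalLift_spec hproj (g • p) (X (proj (g • p)))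
  refine hconn.eq_of_eq hproj ?_ ?_
  · rw [hconn.equivariant, h1, map_zero, h3]
  · rw [h4]
    have h5 := mfderiv_apply_of_eq_comp (h := proj) (hproj.mdifferentiable_proj (g • p))
      ((ContMDiffSMul.contMDiff_const_smul (I := 𝓘(ℝ, EG)) (I' := 𝓘(ℝ, EP)) (n := ∞)
        (M := P) g).mdifferentiable (by simp) p) rfl (fun q ↦ (hproj.proj_smul g q).symm)
      (horizontalLift proj conn p (X (proj p)))
    refine h5.symm.trans (h2.trans ?_)
    have h6 : proj (g • p) = proj p := hproj.proj_smul g p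
    have h7 (x y : M) (h : x = y) : (X y : EM) = X x := by rw [h]
    exact h7 _ _ h6

/-- The connection form applied to a smooth vector field is smooth. -/
lemma IsConnectionForm.contMDiffAt_apply (hconn : IsConnectionForm conn)
    {V : ∀ p : P, TangentSpace 𝓘(ℝ, EP) p} {p : P} (hV : CMDiffAt ∞ (T% V) p) :
    ContMDiffAt (M' := EG) 𝓘(ℝ, EP) 𝓘(ℝ, EG) ∞ (fun q ↦ conn q (V q)) p :=
  (hconn.contMDiff _).comp p hV

/-- The horizontal lift of a smooth vector field is smooth. -/
lemma IsConnectionForm.contMDiffAt_horizontalLift (hproj : IsPrincipalBundle EM EG EP G proj)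
    (hconn : IsConnectionForm conn) {X : ∀ x : M, TangentSpace 𝓘(ℝ, EM) x} {p : P}
    (hX : CMDiffAt ∞ (T% X) (proj p)) :
    CMDiffAt ∞ (T% (fun q : P ↦ horizontalLift proj conn q (X (proj q)))) p := by
  have := hproj.contMDiff_smul
  obtain ⟨V, hV, hVX⟩ := (hproj.submersion p).2.2 X hX
  -- With a smooth local lift `V` the horizontal lift is V - I(ω(V)). Expanding ω(V) in a basis
  -- exhibits the correction as smooth functions times smooth generators.
  let b : Module.Basis _ ℝ EG := Module.finBasis ℝ EG
  let c : ∀ k, P → ℝ := fun k q ↦ b.repr (conn q (V q)) k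
  have hc (k) : ContMDiffAt 𝓘(ℝ, EP) 𝓘(ℝ, ℝ) ∞ (c k) p := by
    let ℓ : EG →ₗ[ℝ] ℝ := b.coord k
    exact (ℓ.toContinuousLinearMap.contDiff.contMDiff _).comp p (hconn.contMDiffAt_apply hV)
  have hS : CMDiffAt ∞ (T% (fun q : P ↦ V q - ∑ k, c k q • infinitesimalAction EG EP G q (b k))) p :=
    hV.sub_section (.sum_section fun k _ ↦ (hc k).smul_section (contMDiff_infinitesimalAction _ p))
  refine hS.congr_of_eventuallyEq ?_
  filter_upwards [hVX] with q hq
  have h1 : ∑ k, c k q • infinitesimalAction EG EP G q (b k) =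
      infinitesimalAction EG EP G q (conn q (V q)) := by
    refine Eq.trans ?_ (congrArg (infinitesimalAction EG EP G q) (b.sum_repr (conn q (V q))))
    exact ((map_sum (infinitesimalAction EG EP G q : EG →L[ℝ] EP) _ _).trans
      (Finset.sum_congr rfl fun k _ ↦ map_smul _ _ _)).symm
  obtain ⟨h2, h3⟩ := hconn.horizontalLift_spec hproj q (X (proj q))
  have h4 : horizontalLift proj conn q (X (proj q)) =
      V q - ∑ k, c k q • infinitesimalAction EG EP G q (b k) := by
    refine hconn.eq_of_eq hproj ?_ ?_
    · rw [h2, h1, map_sub, hconn.apply_infinitesimalAction, sub_self]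
    · rw [h3, h1, map_sub, hproj.mfderiv_proj_infinitesimalAction, sub_zero, hq]
  simp only [h4]

end Bundle

lemma _root_.IsLocalFrameOn.coeff_eq_coord {𝕜 E F H M ι : Type*} [NontriviallyNormedField 𝕜]
    [NormedAddCommGroup E] [NormedSpace 𝕜 E] [TopologicalSpace H] {I : ModelWithCorners 𝕜 E H}
    [TopologicalSpace M] [ChartedSpace H M] [NormedAddCommGroup F] [NormedSpace 𝕜 F] {n : ℕ∞ω}
    {V : M → Type*} [TopologicalSpace (TotalSpace F V)] [∀ x, AddCommGroup (V x)]
    [∀ x, Module 𝕜 (V x)] [∀ x, TopologicalSpace (V x)] [FiberBundle F V]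
    {s : ι → (x : M) → V x} {u : Set M} (hs : IsLocalFrameOn I F n s u) {x : M} (hx : x ∈ u)
    (i : ι) : hs.coeff i x = (hs.toBasisAt hx).coord i :=
  dif_pos hx

lemma _root_.mvfderiv_eq_zero_of_eventually_eq_const {E : Type*} [NormedAddCommGroup E]
    [NormedSpace ℝ E] {H : Type*} [TopologicalSpace H] {I : ModelWithCorners ℝ E H}
    {M : Type*} [TopologicalSpace M] [ChartedSpace H M] {f : M → ℝ} {x : M} {c : ℝ}
    (hf : ∀ᶠ y in 𝓝 x, f y = c) : mvfderiv I f x = 0 := by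
  have h1 : f =ᶠ[𝓝 x] fun _ ↦ c := hf
  rw [mvfderiv, h1.mfderiv_eq, mfderiv_const]
  exact ContinuousLinearMap.ext fun v ↦ map_zero (NormedSpace.fromTangentSpace (𝕜 := ℝ) (f x))

/-- Where `f` is differentiable, the derivative of f² = 1 is 2f df and f is nonzero; elsewhere the
derivative is zero by convention. No continuity of the sign is required. -/
lemma _root_.mvfderiv_eq_zero_of_sq_eq_one {E : Type*} [NormedAddCommGroup E] [NormedSpace ℝ E]
    {H : Type*} [TopologicalSpace H] {I : ModelWithCorners ℝ E H}
    {M : Type*} [TopologicalSpace M] [ChartedSpace H M] {f : M → ℝ} {x : M}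
    (hf : ∀ᶠ y in 𝓝 x, f y = 1 ∨ f y = -1) : mvfderiv I f x = 0 := by
  by_cases hd : MDiffAt f x
  · have h2 : mvfderiv I (f * f) x = 0 := by
      refine mvfderiv_eq_zero_of_eventually_eq_const (c := 1) ?_
      filter_upwards [hf] with y hy
      rcases hy with hy | hy <;> simp [hy]
    rw [mvfderiv_mul hd hd, ← two_smul ℝ, smul_smul] at h2
    refine (smul_eq_zero.1 h2).resolve_left ?_
    rcases hf.self_of_nhds with h | h <;> simp [h]
  · rw [mvfderiv, mfderiv_zero_of_not_mdifferentiableAt hd, ContinuousLinearMap.comp_zero]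

/-! ### The Koszul formula in an orthonormal frame. -/

section Koszul

variable {E : Type*} [NormedAddCommGroup E] [NormedSpace ℝ E] [FiniteDimensional ℝ E]
  {N : Type*} [TopologicalSpace N] [ChartedSpace E N] [IsManifold 𝓘(ℝ, E) ∞ N]

/-- The Koszul formula for an orthonormal frame. -/
lemma IsLeviCivita.koszul {g : ∀ x : N, TangentSpace 𝓘(ℝ, E) x → TangentSpace 𝓘(ℝ, E) x → ℝ}
    {cov : CovariantDerivative 𝓘(ℝ, E) E (TangentSpace 𝓘(ℝ, E) : N → Type _)}
    (hcov : IsLeviCivita g cov) (hsymm : ∀ x u v, g x u v = g x v u)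
    (hsub : ∀ x u v w, g x (u - v) w = g x u w - g x v w)
    {ι : Type*} {s : ι → ∀ x : N, TangentSpace 𝓘(ℝ, E) x} {U : Set N} (hU : IsOpen U)
    (hs : ∀ i, ∀ x ∈ U, MDiffAt (T% (s i)) x) (horth : IsOrthonormalOn g s U)
    {x : N} (hx : x ∈ U) (i j k : ι) :
    2 * g x (cov (s j) x (s i x)) (s k x) =
      g x (mlieBracket 𝓘(ℝ, E) (s i) (s j) x) (s k x) -
        g x (mlieBracket 𝓘(ℝ, E) (s j) (s k) x) (s i x) +
        g x (mlieBracket 𝓘(ℝ, E) (s k) (s i) x) (s j x) := by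
  have : CompleteSpace E := FiniteDimensional.complete ℝ E
  -- Products of frame fields are locally constant or ±1-valued, so metric compatibility makes ⟨∇_c
  -- s_a, s_b⟩ antisymmetric in a and b.
  have hconst (a b c : ι) :
      g x (cov (s a) x (s c x)) (s b x) + g x (cov (s b) x (s c x)) (s a x) = 0 := by
    have h1 := hcov.metric (s a) (s b) x (s c x) (hs a x hx) (hs b x hx)
    have h2 : mvfderiv 𝓘(ℝ, E) (fun y ↦ g y (s a y) (s b y)) x = 0 := by
      by_cases hab : a = b
      · subst hab
        exact mvfderiv_eq_zero_of_sq_eq_one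
          (eventually_of_mem (hU.mem_nhds hx) fun y hy ↦ horth.sq_eq y hy a)
      · exact mvfderiv_eq_zero_of_eventually_eq_const
          (eventually_of_mem (hU.mem_nhds hx) fun y hy ↦ horth.orthogonal y hy a b hab)
    rw [h2, hsymm x (s a x)] at h1
    exact h1.symm
  have htor (a b c : ι) : g x (mlieBracket 𝓘(ℝ, E) (s a) (s b) x) (s c x) =
      g x (cov (s b) x (s a x)) (s c x) - g x (cov (s a) x (s b x)) (s c x) := by
    rw [← hsub, cov.torsion_eq_zero_iff.1 hcov.torsion_eq_zero (hs a x hx) (hs b x hx)]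
  -- Of the resulting six terms, antisymmetry along s_j and s_k cancels four, and along s_i it makes
  -- the other two equal.
  rw [htor, htor, htor]
  linarith [hconst j k i, hconst k i j, hconst i j k]

end Koszul

/-! ### The adapted frame and its dual coframe. -/

section Frame

variable {EM EG EP : Type*}
  [NormedAddCommGroup EM] [NormedSpace ℝ EM] [FiniteDimensional ℝ EM]
  [NormedAddCommGroup EG] [NormedSpace ℝ EG] [FiniteDimensional ℝ EG]
  [NormedAddCommGroup EP] [NormedSpace ℝ EP] [FiniteDimensional ℝ EP]
  {M G P : Type*}
  [TopologicalSpace M] [ChartedSpace EM M] [IsManifold 𝓘(ℝ, EM) ∞ M]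
  [TopologicalSpace G] [ChartedSpace EG G] [Group G] [LieGroup 𝓘(ℝ, EG) ∞ G]
  [TopologicalSpace P] [ChartedSpace EP P] [IsManifold 𝓘(ℝ, EP) ∞ P] [MulAction G P]
  {proj : P → M}
  {conn : ∀ p : P, TangentSpace 𝓘(ℝ, EP) p →L[ℝ] GroupLieAlgebra 𝓘(ℝ, EG) G}
  {ι κ : Type*} [Fintype ι] [Fintype κ]
  {X : ι → ∀ x : M, TangentSpace 𝓘(ℝ, EM) x}
  {b : Module.Basis κ ℝ (GroupLieAlgebra 𝓘(ℝ, EG) G)}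

lemma conn_adaptedFrame_inl (hproj : IsPrincipalBundle EM EG EP G proj)
    (hconn : IsConnectionForm conn) (i : ι) (p : P) :
    conn p (adaptedFrame proj conn X b (.inl i) p) = 0 :=
  (hconn.horizontalLift_spec hproj p (X i (proj p))).1

lemma mfderiv_proj_adaptedFrame_inl (hproj : IsPrincipalBundle EM EG EP G proj)
    (hconn : IsConnectionForm conn) (i : ι) (p : P) :
    mfderiv 𝓘(ℝ, EP) 𝓘(ℝ, EM) proj p (adaptedFrame proj conn X b (.inl i) p) = X i (proj p) :=
  (hconn.horizontalLift_spec hproj p (X i (proj p))).2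

lemma conn_adaptedFrame_inr (hconn : IsConnectionForm conn) (σ : κ) (p : P) :
    conn p (adaptedFrame proj conn X b (.inr σ) p) = b σ :=
  hconn.apply_infinitesimalAction p (b σ)

lemma mfderiv_proj_adaptedFrame_inr (hproj : IsPrincipalBundle EM EG EP G proj) (σ : κ) (p : P) :
    mfderiv 𝓘(ℝ, EP) 𝓘(ℝ, EM) proj p (adaptedFrame proj conn X b (.inr σ) p) = 0 :=
  hproj.mfderiv_proj_infinitesimalAction p (b σ)

variable {θ : Set M}

lemma sum_coeff_smul_frame (hX : IsLocalFrameOn 𝓘(ℝ, EM) EM ∞ X θ)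
    {x : M} (hx : x ∈ θ) (v : TangentSpace 𝓘(ℝ, EM) x) :
    ∑ i, hX.coeff i x v • X i x = v := by
  simpa [hX.coeff_eq_coord hx] using (hX.toBasisAt hx).sum_repr v

lemma mfderiv_proj_sum (hproj : IsPrincipalBundle EM EG EP G proj) (hconn : IsConnectionForm conn)
    (c : ι ⊕ κ → ℝ) (p : P) :
    mfderiv 𝓘(ℝ, EP) 𝓘(ℝ, EM) proj p (∑ A, c A • adaptedFrame proj conn X b A p) =
      ∑ i, c (.inl i) • X i (proj p) := by
  rw [map_sum, Fintype.sum_sum_type]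
  simp only [map_smul, mfderiv_proj_adaptedFrame_inl hproj hconn,
    mfderiv_proj_adaptedFrame_inr hproj, smul_zero, Finset.sum_const_zero, add_zero]

lemma conn_sum (hproj : IsPrincipalBundle EM EG EP G proj) (hconn : IsConnectionForm conn)
    (c : ι ⊕ κ → ℝ) (p : P) :
    conn p (∑ A, c A • adaptedFrame proj conn X b A p) = ∑ σ, c (.inr σ) • b σ := by
  rw [map_sum, Fintype.sum_sum_type]
  simp only [map_smul, conn_adaptedFrame_inl hproj hconn,
    conn_adaptedFrame_inr hconn, smul_zero, Finset.sum_const_zero, zero_add]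

lemma sum_adaptedCoframe_smul_adaptedFrame (hX : IsLocalFrameOn 𝓘(ℝ, EM) EM ∞ X θ)
    (hproj : IsPrincipalBundle EM EG EP G proj)
    (hconn : IsConnectionForm conn) {p : P} (hp : proj p ∈ θ) (v : TangentSpace 𝓘(ℝ, EP) p) :
    ∑ A, adaptedCoframe proj conn hX b A p v • adaptedFrame proj conn X b A p = v := by
  refine hconn.eq_of_eq hproj ?_ ?_
  · rw [conn_sum hproj hconn]
    exact b.sum_repr _
  · rw [mfderiv_proj_sum hproj hconn]
    exact sum_coeff_smul_frame hX hp _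

lemma contMDiffAt_adaptedFrame (hX : IsLocalFrameOn 𝓘(ℝ, EM) EM ∞ X θ)
    (hproj : IsPrincipalBundle EM EG EP G proj)
    (hconn : IsConnectionForm conn) (hθ : IsOpen θ) {p : P} (hp : proj p ∈ θ) (A : ι ⊕ κ) :
    CMDiffAt ∞ (T% (adaptedFrame proj conn X b A)) p := by
  have := hproj.contMDiff_smul
  cases A with
  | inl i => exact hconn.contMDiffAt_horizontalLift hproj (hX.contMDiffAt hθ hp i)
  | inr σ => exact contMDiff_infinitesimalAction (b σ) p

/-- The adapted frame is a smooth local frame of the total space. -/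
lemma isLocalFrameOn_adaptedFrame (hX : IsLocalFrameOn 𝓘(ℝ, EM) EM ∞ X θ)
    (hproj : IsPrincipalBundle EM EG EP G proj)
    (hconn : IsConnectionForm conn) (hθ : IsOpen θ) :
    IsLocalFrameOn 𝓘(ℝ, EP) EP ∞ (adaptedFrame proj conn X b) (proj ⁻¹' θ) where
  linearIndependent {p} hp := by
    refine Fintype.linearIndependent_iff.2 fun c hc A ↦ ?_
    have h1 := mfderiv_proj_sum (X := X) (b := b) hproj hconn c p
    have h2 := conn_sum (X := X) (b := b) hproj hconn c p
    rw [hc, map_zero] at h1 h2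
    cases A with
    | inl i => exact Fintype.linearIndependent_iff.1 (hX.linearIndependent hp) _ h1.symm i
    | inr σ => exact Fintype.linearIndependent_iff.1 b.linearIndependent _ h2.symm σ
  generating {p} hp := by
    rintro v -
    rw [← sum_adaptedCoframe_smul_adaptedFrame (b := b) hX hproj hconn hp v]
    exact Submodule.sum_mem _ fun A _ ↦ Submodule.smul_mem _ _ (Submodule.subset_span ⟨A, rfl⟩)
  contMDiffOn A p hp :=
    (contMDiffAt_adaptedFrame hX hproj hconn hθ hp A).contMDiffWithinAt

/-- The adapted coframe is dual to the adapted frame. -/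
lemma coeff_adaptedFrame (hX : IsLocalFrameOn 𝓘(ℝ, EM) EM ∞ X θ)
    (hproj : IsPrincipalBundle EM EG EP G proj) (hconn : IsConnectionForm conn)
    (he : IsLocalFrameOn 𝓘(ℝ, EP) EP ∞ (adaptedFrame proj conn X b) (proj ⁻¹' θ))
    {p : P} (hp : p ∈ proj ⁻¹' θ) (A : ι ⊕ κ) (v : TangentSpace 𝓘(ℝ, EP) p) :
    he.coeff A p v = adaptedCoframe proj conn hX b A p v := by
  classical
  rw [he.coeff_eq_coord hp, Module.Basis.coord_apply]
  conv_lhs => rw [← sum_adaptedCoframe_smul_adaptedFrame (b := b) hX hproj hconn hp v]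
  have h : ∑ A, adaptedCoframe proj conn hX b A p v • adaptedFrame proj conn X b A p =
      ∑ A, adaptedCoframe proj conn hX b A p v • he.toBasisAt hp A := by
    simp only [he.toBasisAt_coe]
  rw [h, Module.Basis.repr_sum_self]

end Frame

/-! ### Brackets of the adapted frame. -/

section Brackets

variable {EM EG EP : Type*}
  [NormedAddCommGroup EM] [NormedSpace ℝ EM] [FiniteDimensional ℝ EM]
  [NormedAddCommGroup EG] [NormedSpace ℝ EG] [FiniteDimensional ℝ EG]
  [NormedAddCommGroup EP] [NormedSpace ℝ EP] [FiniteDimensional ℝ EP]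
  {M G P : Type*}
  [TopologicalSpace M] [ChartedSpace EM M] [IsManifold 𝓘(ℝ, EM) ∞ M]
  [TopologicalSpace G] [ChartedSpace EG G] [Group G] [LieGroup 𝓘(ℝ, EG) ∞ G]
  [TopologicalSpace P] [ChartedSpace EP P] [IsManifold 𝓘(ℝ, EP) ∞ P] [MulAction G P]
  {proj : P → M}
  {conn : ∀ p : P, TangentSpace 𝓘(ℝ, EP) p →L[ℝ] GroupLieAlgebra 𝓘(ℝ, EG) G}
  {ι κ : Type*} [Fintype ι] [Fintype κ]
  {X : ι → ∀ x : M, TangentSpace 𝓘(ℝ, EM) x}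
  {b : Module.Basis κ ℝ (GroupLieAlgebra 𝓘(ℝ, EG) G)} {θ : Set M}

/-- The vertical part of the bracket of two horizontal lifts is minus the curvature. -/
lemma repr_conn_mlieBracket_inl_inl (hproj : IsPrincipalBundle EM EG EP G proj)
    (hconn : IsConnectionForm conn) (σ : κ) (i j : ι) (p : P) :
    b.repr (conn p (mlieBracket 𝓘(ℝ, EP) (adaptedFrame proj conn X b (.inl i))
      (adaptedFrame proj conn X b (.inl j)) p)) σ = - curvatureComponent proj conn X b σ i j p := by
  -- The e_i are already horizontal and ω(e_i) vanishes identically, so only the bracket term of dω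
  -- survives.
  have hhor (i : ι) : horizontalPart conn (adaptedFrame proj conn X b (.inl i)) =
      adaptedFrame proj conn X b (.inl i) := by
    ext q
    rw [horizontalPart, conn_adaptedFrame_inl hproj hconn, map_zero, sub_zero]
  have hder (i : ι) (v : TangentSpace 𝓘(ℝ, EP) p) :
      directionalDerivative (fun q ↦ conn q (adaptedFrame proj conn X b (.inl i) q)) p v = 0 := by
    simp only [conn_adaptedFrame_inl hproj hconn]
    exact DFunLike.congr_fun (mvfderiv_const (I := 𝓘(ℝ, EP)) (0 : EG) (x := p)) v
  rw [curvatureComponent, curvature, hhor, hhor, exteriorDerivative, hder, hder, sub_self, zero_sub,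
    map_neg, Finsupp.neg_apply, neg_neg]

lemma curvatureComponent_swap (hproj : IsPrincipalBundle EM EG EP G proj)
    (hconn : IsConnectionForm conn) (σ : κ) (i j : ι) (p : P) :
    curvatureComponent proj conn X b σ i j p = - curvatureComponent proj conn X b σ j i p := by
  rw [← repr_conn_mlieBracket_inl_inl hproj hconn, mlieBracket_swap_apply, map_neg, map_neg,
    Finsupp.neg_apply, repr_conn_mlieBracket_inl_inl hproj hconn, neg_neg]

/-- The bracket of horizontal lifts projects to the bracket of the vector fields. -/
lemma mfderiv_proj_mlieBracket_inl_inl (hproj : IsPrincipalBundle EM EG EP G proj)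
    (hconn : IsConnectionForm conn) (hX : IsLocalFrameOn 𝓘(ℝ, EM) EM ∞ X θ) (hθ : IsOpen θ)
    {p : P} (hp : proj p ∈ θ) (i j : ι) :
    mfderiv 𝓘(ℝ, EP) 𝓘(ℝ, EM) proj p (mlieBracket 𝓘(ℝ, EP) (adaptedFrame proj conn X b (.inl i))
      (adaptedFrame proj conn X b (.inl j)) p) = mlieBracket 𝓘(ℝ, EM) (X i) (X j) (proj p) := by
  have : CompleteSpace EP := FiniteDimensional.complete ℝ EP
  have : CompleteSpace EM := FiniteDimensional.complete ℝ EM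
  have hP (i : ι) := (contMDiffAt_adaptedFrame (b := b) hX hproj hconn hθ hp (.inl i)).mdifferentiableAt
    (by simp)
  have hM (i : ι) := (hX.contMDiffAt hθ hp i).mdifferentiableAt (by simp)
  exact mfderiv_mlieBracket_of_related ((hproj.contMDiff_proj.of_le ENat.LEInfty.out) p)
    (hP i) (hP j) (hM i) (hM j)
    (.of_forall fun q ↦ mfderiv_proj_adaptedFrame_inl hproj hconn i q)
    (.of_forall fun q ↦ mfderiv_proj_adaptedFrame_inl hproj hconn j q)

lemma mlieBracket_inr_inl (hproj : IsPrincipalBundle EM EG EP G proj)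
    (hconn : IsConnectionForm conn) (hX : IsLocalFrameOn 𝓘(ℝ, EM) EM ∞ X θ) (hθ : IsOpen θ)
    {p : P} (hp : proj p ∈ θ) (σ : κ) (i : ι) :
    mlieBracket 𝓘(ℝ, EP) (adaptedFrame proj conn X b (.inr σ))
      (adaptedFrame proj conn X b (.inl i)) p = 0 := by
  have : CompleteSpace EP := FiniteDimensional.complete ℝ EP
  have : CompleteSpace EG := FiniteDimensional.complete ℝ EG
  have := hproj.contMDiff_smul
  exact mlieBracket_infinitesimalAction_of_invariant (b σ)
    ((contMDiffAt_adaptedFrame (b := b) hX hproj hconn hθ hp (.inl i)).mdifferentiableAt (by simp))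
    fun g q ↦ hconn.mfderiv_smul_horizontalLift hproj (X i) g q

lemma mlieBracket_inl_inr (hproj : IsPrincipalBundle EM EG EP G proj)
    (hconn : IsConnectionForm conn) (hX : IsLocalFrameOn 𝓘(ℝ, EM) EM ∞ X θ) (hθ : IsOpen θ)
    {p : P} (hp : proj p ∈ θ) (σ : κ) (i : ι) :
    mlieBracket 𝓘(ℝ, EP) (adaptedFrame proj conn X b (.inl i))
      (adaptedFrame proj conn X b (.inr σ)) p = 0 := by
  rw [mlieBracket_swap_apply, mlieBracket_inr_inl hproj hconn hX hθ hp, neg_zero]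

lemma mlieBracket_inr_inr (hproj : IsPrincipalBundle EM EG EP G proj) (p : P) (σ β : κ) :
    mlieBracket 𝓘(ℝ, EP) (adaptedFrame proj conn X b (.inr σ))
      (adaptedFrame proj conn X b (.inr β)) p = - infinitesimalAction EG EP G p ⁅b σ, b β⁆ := by
  have : CompleteSpace EP := FiniteDimensional.complete ℝ EP
  have := hproj.contMDiff_smul
  exact mlieBracket_infinitesimalAction (b σ) (b β) p

end Brackets

/-! ### The bundle metric in the adapted frame. -/

section Metric

variable {EM EG EP : Type*}
  [NormedAddCommGroup EM] [NormedSpace ℝ EM] [FiniteDimensional ℝ EM]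
  [NormedAddCommGroup EG] [NormedSpace ℝ EG] [FiniteDimensional ℝ EG]
  [NormedAddCommGroup EP] [NormedSpace ℝ EP] [FiniteDimensional ℝ EP]
  {M G P : Type*}
  [TopologicalSpace M] [ChartedSpace EM M] [IsManifold 𝓘(ℝ, EM) ∞ M]
  [TopologicalSpace G] [ChartedSpace EG G] [Group G] [LieGroup 𝓘(ℝ, EG) ∞ G]
  [TopologicalSpace P] [ChartedSpace EP P] [IsManifold 𝓘(ℝ, EP) ∞ P] [MulAction G P]
  {proj : P → M}
  {h : ∀ x : M, TangentSpace 𝓘(ℝ, EM) x →L[ℝ] TangentSpace 𝓘(ℝ, EM) x →L[ℝ] ℝ}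
  {K : LinearMap.BilinForm ℝ (GroupLieAlgebra 𝓘(ℝ, EG) G)}
  {conn : ∀ p : P, TangentSpace 𝓘(ℝ, EP) p →L[ℝ] GroupLieAlgebra 𝓘(ℝ, EG) G}
  {ι κ : Type*} [Fintype ι] [Fintype κ] [DecidableEq κ]
  {X : ι → ∀ x : M, TangentSpace 𝓘(ℝ, EM) x}
  {b : Module.Basis κ ℝ (GroupLieAlgebra 𝓘(ℝ, EG) G)} {θ : Set M}

/-- The coefficients in an orthonormal frame are given by the metric. -/
lemma apply_frame_eq_coeff (hX : IsLocalFrameOn 𝓘(ℝ, EM) EM ∞ X θ)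
    (hX_orth : IsOrthonormalOn (fun x u v ↦ h x u v) X θ) {x : M} (hx : x ∈ θ)
    (v : TangentSpace 𝓘(ℝ, EM) x) (i : ι) :
    h x v (X i x) = h x (X i x) (X i x) * hX.coeff i x v := by
  conv_lhs => rw [← sum_coeff_smul_frame hX hx v]
  rw [map_sum, _root_.sum_apply, Finset.sum_eq_single i]
  · rw [map_smul, _root_.smul_apply, smul_eq_mul, mul_comm]
  · intro j _ hj
    rw [map_smul, _root_.smul_apply, hX_orth.orthogonal x hx j i hj, smul_zero]
  · simp

/-- Dividing by ε_i is multiplying by it, since ε_i² = 1. This is the source of the sign ε_i in the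
final formula. -/
lemma coeff_eq_apply_frame (hX : IsLocalFrameOn 𝓘(ℝ, EM) EM ∞ X θ)
    (hX_orth : IsOrthonormalOn (fun x u v ↦ h x u v) X θ) {x : M} (hx : x ∈ θ)
    (v : TangentSpace 𝓘(ℝ, EM) x) (i : ι) :
    hX.coeff i x v = h x (X i x) (X i x) * h x v (X i x) := by
  rw [apply_frame_eq_coeff hX hX_orth hx v i, ← mul_assoc]
  rcases hX_orth.sq_eq x hx i with h1 | h1 <;> rw [h1] <;> ring

lemma bundleMetric_symm (hh : IsPseudoRiemannianMetric h) (hK : IsAdInvariantInnerProduct K)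
    (p : P) (u v : TangentSpace 𝓘(ℝ, EP) p) :
    bundleMetric proj h K conn p u v = bundleMetric proj h K conn p v u := by
  rw [bundleMetric, bundleMetric, hh.symm, hK.symm]

lemma bundleMetric_sub (p : P) (u v w : TangentSpace 𝓘(ℝ, EP) p) :
    bundleMetric proj h K conn p (u - v) w =
      bundleMetric proj h K conn p u w - bundleMetric proj h K conn p v w := by
  simp only [bundleMetric, map_sub, _root_.sub_apply, LinearMap.sub_apply]
  ring

lemma bundleMetric_inl (hproj : IsPrincipalBundle EM EG EP G proj)
    (hconn : IsConnectionForm conn) (p : P) (u : TangentSpace 𝓘(ℝ, EP) p) (i : ι) :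
    bundleMetric proj h K conn p u (adaptedFrame proj conn X b (.inl i) p) =
      h (proj p) (mfderiv 𝓘(ℝ, EP) 𝓘(ℝ, EM) proj p u) (X i (proj p)) := by
  rw [bundleMetric, mfderiv_proj_adaptedFrame_inl hproj hconn,
    conn_adaptedFrame_inl hproj hconn, map_zero, add_zero]

lemma bundleMetric_inr (hproj : IsPrincipalBundle EM EG EP G proj)
    (hconn : IsConnectionForm conn) (hb : ∀ σ β, K (b σ) (b β) = if σ = β then 1 else 0)
    (p : P) (u : TangentSpace 𝓘(ℝ, EP) p) (σ : κ) :
    bundleMetric proj h K conn p u (adaptedFrame proj conn X b (.inr σ) p) =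
      b.repr (conn p u) σ := by
  rw [bundleMetric, mfderiv_proj_adaptedFrame_inr hproj,
    conn_adaptedFrame_inr hconn, map_zero, zero_add, apply_orthonormalBasis_eq_repr hb]

/-- The adapted frame of an orthonormal frame is orthonormal for the bundle metric. -/
lemma isOrthonormalOn_adaptedFrame (hproj : IsPrincipalBundle EM EG EP G proj)
    (hconn : IsConnectionForm conn) (hb : ∀ σ β, K (b σ) (b β) = if σ = β then 1 else 0)
    (hX_orth : IsOrthonormalOn (fun x u v ↦ h x u v) X θ) :
    IsOrthonormalOn (bundleMetric proj h K conn) (adaptedFrame proj conn X b) (proj ⁻¹' θ) where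
  orthogonal p hp A B hAB := by
    cases B with
    | inl j =>
      rw [bundleMetric_inl hproj hconn]
      cases A with
      | inl i =>
        rw [mfderiv_proj_adaptedFrame_inl hproj hconn]
        exact hX_orth.orthogonal _ hp i j fun hij ↦ hAB (by rw [hij])
      | inr σ => rw [mfderiv_proj_adaptedFrame_inr hproj, map_zero, _root_.zero_apply]
    | inr β =>
      rw [bundleMetric_inr hproj hconn hb]
      cases A with
      | inl i => rw [conn_adaptedFrame_inl hproj hconn, map_zero, Finsupp.zero_apply]
      | inr σ =>
        rw [conn_adaptedFrame_inr hconn, b.repr_self,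
          Finsupp.single_eq_of_ne fun hσ ↦ hAB (by rw [hσ])]
  sq_eq p hp A := by
    cases A with
    | inl i =>
      rw [bundleMetric_inl hproj hconn, mfderiv_proj_adaptedFrame_inl hproj hconn]
      exact hX_orth.sq_eq _ hp i
    | inr σ =>
      rw [bundleMetric_inr hproj hconn hb, conn_adaptedFrame_inr hconn, b.repr_self,
        Finsupp.single_eq_same]
      exact Or.inl rfl

end Metric

/-! ### The connection forms of the bundle metric. -/

section LeviCivita

variable {EM EG EP : Type*}
  [NormedAddCommGroup EM] [NormedSpace ℝ EM] [FiniteDimensional ℝ EM]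
  [NormedAddCommGroup EG] [NormedSpace ℝ EG] [FiniteDimensional ℝ EG]
  [NormedAddCommGroup EP] [NormedSpace ℝ EP] [FiniteDimensional ℝ EP]
  {M G P : Type*}
  [TopologicalSpace M] [ChartedSpace EM M] [IsManifold 𝓘(ℝ, EM) ∞ M]
  [TopologicalSpace G] [ChartedSpace EG G] [Group G] [LieGroup 𝓘(ℝ, EG) ∞ G]
  [TopologicalSpace P] [ChartedSpace EP P] [IsManifold 𝓘(ℝ, EP) ∞ P] [MulAction G P]
  {proj : P → M}
  {h : ∀ x : M, TangentSpace 𝓘(ℝ, EM) x →L[ℝ] TangentSpace 𝓘(ℝ, EM) x →L[ℝ] ℝ}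
  {K : LinearMap.BilinForm ℝ (GroupLieAlgebra 𝓘(ℝ, EG) G)}
  {conn : ∀ p : P, TangentSpace 𝓘(ℝ, EP) p →L[ℝ] GroupLieAlgebra 𝓘(ℝ, EG) G}
  {ι κ : Type*} [Fintype ι] [Fintype κ] [DecidableEq κ]
  {X : ι → ∀ x : M, TangentSpace 𝓘(ℝ, EM) x}
  {b : Module.Basis κ ℝ (GroupLieAlgebra 𝓘(ℝ, EG) G)} {θ : Set M}
  {covM : CovariantDerivative 𝓘(ℝ, EM) EM (TangentSpace 𝓘(ℝ, EM) : M → Type _)}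
  {covP : CovariantDerivative 𝓘(ℝ, EP) EP (TangentSpace 𝓘(ℝ, EP) : P → Type _)}

lemma bundleMetric_zero_left (p : P) (u : TangentSpace 𝓘(ℝ, EP) p) :
    bundleMetric proj h K conn p 0 u = 0 := by
  rw [bundleMetric, map_zero, map_zero, map_zero, map_zero, _root_.zero_apply,
    LinearMap.zero_apply, add_zero]

lemma repr_conn_mlieBracket_inr_inr (hproj : IsPrincipalBundle EM EG EP G proj)
    (hconn : IsConnectionForm conn) (γ σ β : κ) (p : P) :
    b.repr (conn p (mlieBracket 𝓘(ℝ, EP) (adaptedFrame proj conn X b (.inr σ))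
      (adaptedFrame proj conn X b (.inr β)) p)) γ = - structureConstant b γ σ β := by
  rw [mlieBracket_inr_inr hproj, map_neg, hconn.apply_infinitesimalAction, map_neg,
    Finsupp.neg_apply, structureConstant]

lemma mfderiv_proj_mlieBracket_inr_inr (hproj : IsPrincipalBundle EM EG EP G proj)
    (σ β : κ) (p : P) :
    mfderiv 𝓘(ℝ, EP) 𝓘(ℝ, EM) proj p (mlieBracket 𝓘(ℝ, EP) (adaptedFrame proj conn X b (.inr σ))
      (adaptedFrame proj conn X b (.inr β)) p) = 0 := by
  rw [mlieBracket_inr_inr hproj, map_neg, hproj.mfderiv_proj_infinitesimalAction, neg_zero]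

/-- The Koszul formula for the adapted frame. -/
lemma koszul_adaptedFrame (hproj : IsPrincipalBundle EM EG EP G proj)
    (hh : IsPseudoRiemannianMetric h) (hK : IsAdInvariantInnerProduct K)
    (hconn : IsConnectionForm conn) (hθ : IsOpen θ) (hX : IsLocalFrameOn 𝓘(ℝ, EM) EM ∞ X θ)
    (hX_orth : IsOrthonormalOn (fun x u v ↦ h x u v) X θ)
    (hb : ∀ σ β, K (b σ) (b β) = if σ = β then 1 else 0)
    (hcovP : IsLeviCivita (bundleMetric proj h K conn) covP) {p : P} (hp : proj p ∈ θ)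
    (A B C : ι ⊕ κ) :
    2 * bundleMetric proj h K conn p
        (covP (adaptedFrame proj conn X b B) p (adaptedFrame proj conn X b A p))
        (adaptedFrame proj conn X b C p) =
      bundleMetric proj h K conn p (mlieBracket 𝓘(ℝ, EP) (adaptedFrame proj conn X b A)
          (adaptedFrame proj conn X b B) p) (adaptedFrame proj conn X b C p) -
        bundleMetric proj h K conn p (mlieBracket 𝓘(ℝ, EP) (adaptedFrame proj conn X b B)
          (adaptedFrame proj conn X b C) p) (adaptedFrame proj conn X b A p) +
        bundleMetric proj h K conn p (mlieBracket 𝓘(ℝ, EP) (adaptedFrame proj conn X b C)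
          (adaptedFrame proj conn X b A) p) (adaptedFrame proj conn X b B p) :=
  hcovP.koszul (bundleMetric_symm hh hK) bundleMetric_sub
    (hθ.preimage hproj.contMDiff_proj.continuous)
    (fun A _ hq ↦ (contMDiffAt_adaptedFrame hX hproj hconn hθ hq A).mdifferentiableAt (by simp))
    (isOrthonormalOn_adaptedFrame hproj hconn hb hX_orth) hp A B C

/-- By linearity, a connection form need only be computed on the frame vectors. -/
lemma connectionForm_eq_sum (hX : IsLocalFrameOn 𝓘(ℝ, EM) EM ∞ X θ)
    (hproj : IsPrincipalBundle EM EG EP G proj) (hconn : IsConnectionForm conn)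
    (he : IsLocalFrameOn 𝓘(ℝ, EP) EP ∞ (adaptedFrame proj conn X b) (proj ⁻¹' θ))
    {p : P} (hp : proj p ∈ θ) (A B : ι ⊕ κ) (v : TangentSpace 𝓘(ℝ, EP) p) :
    connectionForm he covP A B p v =
      ∑ k, connectionForm he covP A B p (adaptedFrame proj conn X b (.inl k) p) *
          adaptedCoframe proj conn hX b (.inl k) p v +
        ∑ ν, connectionForm he covP A B p (adaptedFrame proj conn X b (.inr ν) p) *
          adaptedCoframe proj conn hX b (.inr ν) p v := by
  conv_lhs => rw [← sum_adaptedCoframe_smul_adaptedFrame (b := b) hX hproj hconn hp v]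
  simp only [connectionForm, map_add, map_sum, map_smul, smul_eq_mul, Fintype.sum_sum_type, mul_comm]

lemma connectionForm_inl (hX : IsLocalFrameOn 𝓘(ℝ, EM) EM ∞ X θ)
    (hX_orth : IsOrthonormalOn (fun x u v ↦ h x u v) X θ)
    (hproj : IsPrincipalBundle EM EG EP G proj) (hconn : IsConnectionForm conn)
    (he : IsLocalFrameOn 𝓘(ℝ, EP) EP ∞ (adaptedFrame proj conn X b) (proj ⁻¹' θ))
    {p : P} (hp : proj p ∈ θ) (i : ι) (B : ι ⊕ κ) (v : TangentSpace 𝓘(ℝ, EP) p) :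
    connectionForm he covP (.inl i) B p v =
      h (proj p) (X i (proj p)) (X i (proj p)) *
        bundleMetric proj h K conn p (covP (adaptedFrame proj conn X b B) p v)
          (adaptedFrame proj conn X b (.inl i) p) := by
  rw [connectionForm, coeff_adaptedFrame hX hproj hconn he hp, bundleMetric_inl hproj hconn]
  exact coeff_eq_apply_frame hX hX_orth hp _ i

lemma connectionForm_inr (hX : IsLocalFrameOn 𝓘(ℝ, EM) EM ∞ X θ)
    (hproj : IsPrincipalBundle EM EG EP G proj) (hconn : IsConnectionForm conn)
    (hb : ∀ σ β, K (b σ) (b β) = if σ = β then 1 else 0)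
    (he : IsLocalFrameOn 𝓘(ℝ, EP) EP ∞ (adaptedFrame proj conn X b) (proj ⁻¹' θ))
    {p : P} (hp : proj p ∈ θ) (σ : κ) (B : ι ⊕ κ) (v : TangentSpace 𝓘(ℝ, EP) p) :
    connectionForm he covP (.inr σ) B p v =
      bundleMetric proj h K conn p (covP (adaptedFrame proj conn X b B) p v)
        (adaptedFrame proj conn X b (.inr σ) p) := by
  rw [connectionForm, coeff_adaptedFrame hX hproj hconn he hp, bundleMetric_inr hproj hconn hb]
  rfl

/-- The connection forms `ϖ^i_j` of the bundle metric. -/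
lemma connectionForm_inl_inl (hproj : IsPrincipalBundle EM EG EP G proj)
    (hh : IsPseudoRiemannianMetric h) (hK : IsAdInvariantInnerProduct K)
    (hconn : IsConnectionForm conn) (hθ : IsOpen θ) (hX : IsLocalFrameOn 𝓘(ℝ, EM) EM ∞ X θ)
    (hX_orth : IsOrthonormalOn (fun x u v ↦ h x u v) X θ)
    (hb : ∀ σ β, K (b σ) (b β) = if σ = β then 1 else 0)
    (hcovM : IsLeviCivita (fun x u v ↦ h x u v) covM)
    (hcovP : IsLeviCivita (bundleMetric proj h K conn) covP)
    (he : IsLocalFrameOn 𝓘(ℝ, EP) EP ∞ (adaptedFrame proj conn X b) (proj ⁻¹' θ))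
    {p : P} (hp : proj p ∈ θ) (v : TangentSpace 𝓘(ℝ, EP) p) (i j : ι) :
    connectionForm he covP (.inl i) (.inl j) p v =
      connectionForm hX covM i j (proj p) (mfderiv 𝓘(ℝ, EP) 𝓘(ℝ, EM) proj p v) -
        1 / 2 * h (proj p) (X i (proj p)) (X i (proj p)) *
          ∑ σ : κ, curvatureComponent proj conn X b σ i j p *
            adaptedCoframe proj conn hX b (.inr σ) p v := by
  have hbase : connectionForm hX covM i j (proj p) (mfderiv 𝓘(ℝ, EP) 𝓘(ℝ, EM) proj p v) =
      ∑ k, connectionForm hX covM i j (proj p) (X k (proj p)) *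
        adaptedCoframe proj conn hX b (.inl k) p v := by
    conv_lhs => rw [← sum_coeff_smul_frame hX hp (mfderiv 𝓘(ℝ, EP) 𝓘(ℝ, EM) proj p v)]
    simp only [connectionForm, map_sum, map_smul, smul_eq_mul, mul_comm, adaptedCoframe]
  -- Pairing with a horizontal field sees only dπ, and brackets of lifts project to brackets on M.
  -- The Koszul formulas upstairs and downstairs therefore agree term by term.
  have hhor (k : ι) : connectionForm he covP (.inl i) (.inl j) p
      (adaptedFrame proj conn X b (.inl k) p) =
        connectionForm hX covM i j (proj p) (X k (proj p)) := by
    have h1 := koszul_adaptedFrame hproj hh hK hconn hθ hX hX_orth hb hcovP hp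
      (.inl k) (.inl j) (.inl i)
    have h2 := hcovM.koszul hh.symm (fun x u v w ↦ by rw [map_sub, _root_.sub_apply]) hθ
      (fun i x hx ↦ (hX.contMDiffAt hθ hx i).mdifferentiableAt (by simp)) hX_orth hp k j i
    simp only [bundleMetric_inl hproj hconn,
      mfderiv_proj_mlieBracket_inl_inl hproj hconn hX hθ hp] at h1
    rw [connectionForm_inl (K := K) hX hX_orth hproj hconn he hp, connectionForm,
      coeff_eq_apply_frame hX hX_orth hp, bundleMetric_inl hproj hconn]
    congr 1
    linarith
  -- Mixed brackets vanish, so only -α([e_j, e_i], e_ν) = F^ν_{ji} = -F^ν_{ij} survives.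
  have hver (ν : κ) : connectionForm he covP (.inl i) (.inl j) p
      (adaptedFrame proj conn X b (.inr ν) p) = -(1 / 2) *
        h (proj p) (X i (proj p)) (X i (proj p)) * curvatureComponent proj conn X b ν i j p := by
    have h1 := koszul_adaptedFrame hproj hh hK hconn hθ hX hX_orth hb hcovP hp
      (.inr ν) (.inl j) (.inl i)
    rw [mlieBracket_inr_inl hproj hconn hX hθ hp, mlieBracket_inl_inr hproj hconn hX hθ hp,
      bundleMetric_zero_left, bundleMetric_zero_left, bundleMetric_inr hproj hconn hb,
      repr_conn_mlieBracket_inl_inl hproj hconn, curvatureComponent_swap hproj hconn] at h1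
    rw [connectionForm_inl (K := K) hX hX_orth hproj hconn he hp]
    linear_combination (1 / 2) * h (proj p) (X i (proj p)) (X i (proj p)) * h1
  rw [connectionForm_eq_sum hX hproj hconn he hp, hbase, Finset.mul_sum, sub_eq_add_neg,
    ← Finset.sum_neg_distrib]
  refine congrArg₂ _ (Finset.sum_congr rfl fun k _ ↦ by rw [hhor])
    (Finset.sum_congr rfl fun ν _ ↦ by rw [hver]; ring)

/-- The connection forms `ϖ^σ_i` of the bundle metric. -/
lemma connectionForm_inr_inl (hproj : IsPrincipalBundle EM EG EP G proj)
    (hh : IsPseudoRiemannianMetric h) (hK : IsAdInvariantInnerProduct K)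
    (hconn : IsConnectionForm conn) (hθ : IsOpen θ) (hX : IsLocalFrameOn 𝓘(ℝ, EM) EM ∞ X θ)
    (hX_orth : IsOrthonormalOn (fun x u v ↦ h x u v) X θ)
    (hb : ∀ σ β, K (b σ) (b β) = if σ = β then 1 else 0)
    (hcovP : IsLeviCivita (bundleMetric proj h K conn) covP)
    (he : IsLocalFrameOn 𝓘(ℝ, EP) EP ∞ (adaptedFrame proj conn X b) (proj ⁻¹' θ))
    {p : P} (hp : proj p ∈ θ) (v : TangentSpace 𝓘(ℝ, EP) p) (σ : κ) (i : ι) :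
    connectionForm he covP (.inr σ) (.inl i) p v =
      1 / 2 * ∑ j : ι, curvatureComponent proj conn X b σ i j p *
        adaptedCoframe proj conn hX b (.inl j) p v := by
  -- Here the surviving term is α([e_k, e_i], e_σ) = -F^σ_{ki} = F^σ_{ik}.
  have hhor (k : ι) : connectionForm he covP (.inr σ) (.inl i) p
      (adaptedFrame proj conn X b (.inl k) p) =
        1 / 2 * curvatureComponent proj conn X b σ i k p := by
    have h1 := koszul_adaptedFrame hproj hh hK hconn hθ hX hX_orth hb hcovP hp
      (.inl k) (.inl i) (.inr σ)
    rw [mlieBracket_inr_inl hproj hconn hX hθ hp, mlieBracket_inl_inr hproj hconn hX hθ hp,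
      bundleMetric_zero_left, bundleMetric_zero_left,
      bundleMetric_inr hproj hconn hb p (mlieBracket _ _ _ _),
      repr_conn_mlieBracket_inl_inl hproj hconn, curvatureComponent_swap hproj hconn] at h1
    rw [connectionForm_inr (h := h) (K := K) hX hproj hconn hb he hp]
    linarith
  -- The only nonzero bracket, [e_σ, e_ν], is vertical and is paired with the horizontal e_i.
  have hver (ν : κ) : connectionForm he covP (.inr σ) (.inl i) p
      (adaptedFrame proj conn X b (.inr ν) p) = 0 := by
    have h1 := koszul_adaptedFrame hproj hh hK hconn hθ hX hX_orth hb hcovP hp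
      (.inr ν) (.inl i) (.inr σ)
    rw [mlieBracket_inr_inl hproj hconn hX hθ hp, mlieBracket_inl_inr hproj hconn hX hθ hp,
      bundleMetric_zero_left, bundleMetric_zero_left, bundleMetric_inl hproj hconn,
      mfderiv_proj_mlieBracket_inr_inr hproj, map_zero, _root_.zero_apply] at h1
    rw [connectionForm_inr (h := h) (K := K) hX hproj hconn hb he hp]
    linarith
  rw [connectionForm_eq_sum hX hproj hconn he hp]
  simp only [hhor, hver, zero_mul, Finset.sum_const_zero, add_zero, Finset.mul_sum, mul_assoc]

/-- The connection forms `ϖ^σ_β` of the bundle metric. -/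
lemma connectionForm_inr_inr (hproj : IsPrincipalBundle EM EG EP G proj)
    (hh : IsPseudoRiemannianMetric h) (hK : IsAdInvariantInnerProduct K)
    (hconn : IsConnectionForm conn) (hθ : IsOpen θ) (hX : IsLocalFrameOn 𝓘(ℝ, EM) EM ∞ X θ)
    (hX_orth : IsOrthonormalOn (fun x u v ↦ h x u v) X θ)
    (hb : ∀ σ β, K (b σ) (b β) = if σ = β then 1 else 0)
    (hcovP : IsLeviCivita (bundleMetric proj h K conn) covP)
    (he : IsLocalFrameOn 𝓘(ℝ, EP) EP ∞ (adaptedFrame proj conn X b) (proj ⁻¹' θ))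
    {p : P} (hp : proj p ∈ θ) (v : TangentSpace 𝓘(ℝ, EP) p) (σ β : κ) :
    connectionForm he covP (.inr σ) (.inr β) p v =
      -(1 / 2) * ∑ ν : κ, structureConstant b σ ν β *
        adaptedCoframe proj conn hX b (.inr ν) p v := by
  have hhor (k : ι) : connectionForm he covP (.inr σ) (.inr β) p
      (adaptedFrame proj conn X b (.inl k) p) = 0 := by
    have h1 := koszul_adaptedFrame hproj hh hK hconn hθ hX hX_orth hb hcovP hp
      (.inl k) (.inr β) (.inr σ)
    rw [mlieBracket_inr_inl hproj hconn hX hθ hp, mlieBracket_inl_inr hproj hconn hX hθ hp,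
      bundleMetric_zero_left, bundleMetric_zero_left, bundleMetric_inl hproj hconn,
      mfderiv_proj_mlieBracket_inr_inr hproj, map_zero, _root_.zero_apply] at h1
    rw [connectionForm_inr (h := h) (K := K) hX hproj hconn hb he hp]
    linarith
  -- The Koszul terms are -C^σ_{νβ} + C^ν_{βσ} - C^β_{σν}. Total antisymmetry makes the three
  -- constants equal, leaving -C^σ_{νβ}.
  have hver (ν : κ) : connectionForm he covP (.inr σ) (.inr β) p
      (adaptedFrame proj conn X b (.inr ν) p) = -(1 / 2) * structureConstant b σ ν β := by
    have h1 := koszul_adaptedFrame hproj hh hK hconn hθ hX hX_orth hb hcovP hp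
      (.inr ν) (.inr β) (.inr σ)
    simp only [bundleMetric_inr hproj hconn hb, repr_conn_mlieBracket_inr_inr hproj hconn] at h1
    rw [connectionForm_inr (h := h) (K := K) hX hproj hconn hb he hp, bundleMetric_inr hproj hconn hb]
    linarith [structureConstant_antisymm hK hb ν β σ, structureConstant_swap (b := b) σ β ν,
      structureConstant_swap (b := b) β σ ν, structureConstant_antisymm hK hb β ν σ]
  rw [connectionForm_eq_sum hX hproj hconn he hp]
  simp only [hhor, hver, zero_mul, Finset.sum_const_zero, zero_add, Finset.mul_sum, mul_assoc]

end LeviCivita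

end KaluzaKlein

end AdaptedFrames

theorem mainTheorem12
    {EM EG EP : Type*}
    [NormedAddCommGroup EM] [NormedSpace ℝ EM] [FiniteDimensional ℝ EM]
    [NormedAddCommGroup EG] [NormedSpace ℝ EG] [FiniteDimensional ℝ EG]
    [NormedAddCommGroup EP] [NormedSpace ℝ EP] [FiniteDimensional ℝ EP]
    {M G P : Type*}
    [TopologicalSpace M] [ChartedSpace EM M] [IsManifold 𝓘(ℝ, EM) ∞ M]
    [TopologicalSpace G] [ChartedSpace EG G] [Group G] [LieGroup 𝓘(ℝ, EG) ∞ G]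
    [TopologicalSpace P] [ChartedSpace EP P] [IsManifold 𝓘(ℝ, EP) ∞ P] [MulAction G P]
    (proj : P → M) (hproj : KaluzaKlein.IsPrincipalBundle EM EG EP G proj)
    (h : ∀ x : M, TangentSpace 𝓘(ℝ, EM) x →L[ℝ] TangentSpace 𝓘(ℝ, EM) x →L[ℝ] ℝ)
    (hh : KaluzaKlein.IsPseudoRiemannianMetric h)
    (K : LinearMap.BilinForm ℝ (GroupLieAlgebra 𝓘(ℝ, EG) G))
    (hK : KaluzaKlein.IsAdInvariantInnerProduct K)
    (conn : ∀ p : P, TangentSpace 𝓘(ℝ, EP) p →L[ℝ] GroupLieAlgebra 𝓘(ℝ, EG) G)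
    (hconn : KaluzaKlein.IsConnectionForm conn)
    {ι κ : Type*} [Fintype ι] [Fintype κ] [DecidableEq κ]
    (θ : Set M) (hθ : IsOpen θ)
    (X : ι → ∀ x : M, TangentSpace 𝓘(ℝ, EM) x)
    (hX : IsLocalFrameOn 𝓘(ℝ, EM) EM ∞ X θ)
    (hX_orth : KaluzaKlein.IsOrthonormalOn (fun x u v ↦ h x u v) X θ)
    (b : Module.Basis κ ℝ (GroupLieAlgebra 𝓘(ℝ, EG) G))
    (hb : ∀ σ β, K (b σ) (b β) = if σ = β then 1 else 0)
    (covM : CovariantDerivative 𝓘(ℝ, EM) EM (TangentSpace 𝓘(ℝ, EM) : M → Type _))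
    (hcovM : KaluzaKlein.IsLeviCivita (fun x u v ↦ h x u v) covM)
    (covP : CovariantDerivative 𝓘(ℝ, EP) EP (TangentSpace 𝓘(ℝ, EP) : P → Type _))
    (hcovP : KaluzaKlein.IsLeviCivita (KaluzaKlein.bundleMetric proj h K conn) covP) :
    ∃ he : IsLocalFrameOn 𝓘(ℝ, EP) EP ∞ (KaluzaKlein.adaptedFrame proj conn X b) (proj ⁻¹' θ),
      KaluzaKlein.IsOrthonormalOn (KaluzaKlein.bundleMetric proj h K conn)
        (KaluzaKlein.adaptedFrame proj conn X b) (proj ⁻¹' θ) ∧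
      (∀ p ∈ proj ⁻¹' θ, ∀ (A : ι ⊕ κ) (v : TangentSpace 𝓘(ℝ, EP) p),
        he.coeff A p v = KaluzaKlein.adaptedCoframe proj conn hX b A p v) ∧
      ∀ p ∈ proj ⁻¹' θ, ∀ v : TangentSpace 𝓘(ℝ, EP) p,
        (∀ i j : ι,
          KaluzaKlein.connectionForm he covP (.inl i) (.inl j) p v =
            KaluzaKlein.connectionForm hX covM i j (proj p) (mfderiv 𝓘(ℝ, EP) 𝓘(ℝ, EM) proj p v) -
              1 / 2 * h (proj p) (X i (proj p)) (X i (proj p)) *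
                ∑ σ : κ, KaluzaKlein.curvatureComponent proj conn X b σ i j p *
                  KaluzaKlein.adaptedCoframe proj conn hX b (.inr σ) p v) ∧
        (∀ (σ : κ) (i : ι),
          KaluzaKlein.connectionForm he covP (.inr σ) (.inl i) p v =
            1 / 2 * ∑ j : ι, KaluzaKlein.curvatureComponent proj conn X b σ i j p *
              KaluzaKlein.adaptedCoframe proj conn hX b (.inl j) p v) ∧
        (∀ σ β : κ,
          KaluzaKlein.connectionForm he covP (.inr σ) (.inr β) p v =
            -(1 / 2) * ∑ ν : κ, KaluzaKlein.structureConstant b σ ν β *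
              KaluzaKlein.adaptedCoframe proj conn hX b (.inr ν) p v) := by
  refine ⟨KaluzaKlein.isLocalFrameOn_adaptedFrame hX hproj hconn hθ,
    KaluzaKlein.isOrthonormalOn_adaptedFrame hproj hconn hb hX_orth,
    fun p hp A v ↦ KaluzaKlein.coeff_adaptedFrame hX hproj hconn _ hp A v,
    fun p hp v ↦ ⟨fun i j ↦ ?_, fun σ i ↦ ?_, fun σ β ↦ ?_⟩⟩
  · exact KaluzaKlein.connectionForm_inl_inl hproj hh hK hconn hθ hX hX_orth hb hcovM hcovP _ hp v i j
  · exact KaluzaKlein.connectionForm_inr_inl hproj hh hK hconn hθ hX hX_orth hb hcovP _ hp v σ i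
  · exact KaluzaKlein.connectionForm_inr_inr hproj hh hK hconn hθ hX hX_orth hb hcovP _ hp v σ β
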